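/- Let $U=[-1,1]^{\mathbb N}$ carry the product topology and the measure $\mu=\bigotimes_{j\in\mathbb N}\frac{\lambda}{2}$ ($\lambda$ the Lebesgue measure on $[-1,1]$). For $r>0$, $S\subseteq\mathbb C$ let $\mathcal B_r(S)=\{z\in\mathbb C:\exists y\in S,\ |z-y|<r\}$, $\mathcal B_r=\mathcal B_r(\{0\})$, $\mathcal B_r(1)=\mathcal B_r(\{1\})$; for $\boldsymbol\delta\in(0,\infty)^k$ and $j\le k$ let $\boldsymbol\delta_{[j]}=(\delta_i)_{i=1}^j$, $\mathcal B_{\boldsymbol\delta}(S)=\prod_{i=1}^k\mathcal B_{\delta_i}(S)$, $\mathcal B_{\boldsymbol\delta}=\mathcal B_{\boldsymbol\delta}(\{0\})$ and $\mathcal B_{\boldsymbol\delta}([-1,1])\times U=\prod_{i\le k}\mathcal B_{\delta_i}([-1,1])\times\prod_{i>k}[-1,1]\subset\mathbb C^{\mathbb N}$. For a continuous positive probability density $f$ on $U$ (with respect to $\mu$) let $\hat f_0=1$, $\hat f_n(\boldsymbol x)=\int_U f(\boldsymbol x,\boldsymbol t)\,\mu(d\boldsymbol t)$ for $\boldsymbol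 x\in[-1,1]^n$, $f_n(\boldsymbol x)=\hat f_n(\boldsymbol x)/\hat f_{n-1}(\boldsymbol x_{[n-1]})$ and $F_{n}(\boldsymbol x_{[n-1]},x_n)=\int_{-1}^{x_n}f_n(\boldsymbol x_{[n-1]},t)\,\frac{dt}{2}$. For two such densities $f_\rho$, $f_\pi$, with conditional distribution functions $F_{\rho;n}$, $F_{\pi;n}$, the Knothe--Rosenblatt transport $T=(T_n)_{n\in\mathbb N}$ is given recursively by $T_n(\boldsymbol x_{[n-1]},\cdot)=F_{\pi;n}(T_1(x_1),\dots,T_{n-1}(\boldsymbol x_{[n-1]}),\cdot)^{-1}\circ F_{\rho;n}(\boldsymbol x_{[n-1]},\cdot)$ on $[-1,1]$. **Theorem.** Let $0<\tilde M\le\tilde L<\infty$. There exist $\tilde C_6,\tilde C_7\in(0,1]$ and $\tilde C_8>0$, depending only on $\tilde M$ and $\tilde L$, such that the following holds for all $k\in\mathbb N$ and $\boldsymbol\delta\in(0,\infty)^k$. Suppose that for $*\in\{\rho,\pi\}$: (a) $f_*:\mathcal B_{\boldsymbol\delta}([-1,1])\times U\to\mathbb C$ is continuous; (b) $f_*$ restricted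 to $U$ is a positive probability density, and $f_*(\cdot,\boldsymbol y)$ is holomorphic on $\mathcal B_{\boldsymbol\delta}([-1,1])$ for every $\boldsymbol y\in U$; (c) $\tilde M\le|f_*(\boldsymbol x)|\le\tilde L$ for all $\boldsymbol x\in\mathcal B_{\boldsymbol\delta}([-1,1])\times U$; (d) $\sup_{\boldsymbol y\in\mathcal B_{\boldsymbol\delta}\times\{0\}^{\mathbb N}}|f_*(\boldsymbol x+\boldsymbol y)-f_*(\boldsymbol x)|\le\tilde C_6$ for all $\boldsymbol x\in U$; (e) $\sup_{\boldsymbol y\in\mathcal B_{\boldsymbol\delta_{[j]}}\times\{0\}^{\mathbb N}}|f_*(\boldsymbol x+\boldsymbol y)-f_*(\boldsymbol x)|\le\tilde C_6\,\delta_{j+1}$ for all $\boldsymbol x\in U$ and $j\in\{1,\dots,k-1\}$. Let $T$ be the Knothe--Rosenblatt transport for $f_\rho,f_\pi$ and $\zeta_j=\tilde C_7\delta_j$ for $j\in\{1,\dots,k\}$. Then for every $j\in\{1,\dots,k\}$ the partial derivative $R_j=\partial_{x_j}T_j$ exists on $[-1,1]^j$ and extends to a holomorphic function $R_j:\mathcal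 B_{\boldsymbol\zeta_{[j]}}([-1,1])\to\mathcal B_{\tilde C_8}(1)$ with $\Re R_j(\boldsymbol x)\ge 1/\tilde C_8$ for all $\boldsymbol x\in\mathcal B_{\boldsymbol\zeta_{[j]}}([-1,1])$; moreover, if $j\ge2$, then $R_j$ maps $\mathcal B_{\boldsymbol\zeta_{[j-1]}}([-1,1])\times[-1,1]$ into $\mathcal B_{\tilde C_8/\delta_j}(1)$. -/

import Mathlib

open MeasureTheory

noncomputable section

namespace KnotheRosenblatt

/-- The real interval `[-1,1]`, seen inside `ℂ`. -/
def realSeg : Set ℂ := (fun x : ℝ => (x : ℂ)) '' Set.Icc (-1) 1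

/-- The real cube `U = [-1,1]^ℕ`. Coordinates are numbered from `0`. -/
def cube : Set (ℕ → ℝ) := {x | ∀ i, x i ∈ Set.Icc (-1 : ℝ) 1}

/-- Coordinatewise embedding of real vectors (or sequences) into complex ones. -/
def toC {ι : Type*} (x : ι → ℝ) : ι → ℂ := fun i => (x i : ℂ)

/-- The sequence `(z, y)`: the vector `z` followed by the sequence `y`. -/
def concat {α : Type*} {n : ℕ} (z : Fin n → α) (y : ℕ → α) : ℕ → α :=
  fun i => if h : i < n then z ⟨i, h⟩ else y (i - n)

/-- `B_ρ([-1,1]) = ∏_i B_{ρ_i}([-1,1]) ⊆ ℂⁿ`, the product of the open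
`ρ_i`-neighbourhoods of `[-1,1]` in `ℂ`. -/
def nbhdBox {n : ℕ} (ρ : Fin n → ℝ) : Set (Fin n → ℂ) :=
  {z | ∀ i, z i ∈ Metric.thickening (ρ i) realSeg}

/-- `B_ρ([-1,1]) × U ⊆ ℂ^ℕ`. -/
def nbhdBoxTimesCube {k : ℕ} (ρ : Fin k → ℝ) : Set (ℕ → ℂ) :=
  {w | (∀ i : Fin k, w i ∈ Metric.thickening (ρ i) realSeg) ∧ ∀ i, k ≤ i → w i ∈ realSeg}

/-- `B_{ρ_[j]} × {0}^ℕ ⊆ ℂ^ℕ`: the first `j` entries lie in the open discs of radii `ρ_i`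
around `0`, the others vanish. Used for `j ≤ k`. -/
def discBoxTimesZero {k : ℕ} (ρ : Fin k → ℝ) (j : ℕ) : Set (ℕ → ℂ) :=
  {y | (∀ i : Fin k, (i : ℕ) < j → ‖y i‖ < ρ i) ∧ ∀ i, j ≤ i → y i = 0}

/-- The uniform probability measure `λ/2` on `[-1,1]`, as a measure on `ℝ`. -/
def unif : Measure ℝ := (2⁻¹ : ENNReal) • volume.restrict (Set.Icc (-1) 1)

instance : IsProbabilityMeasure unif := by
  constructor
  have h : (1 : ℝ) - -1 = 2 := by norm_num
  simp only [unif, Measure.smul_apply, Measure.restrict_apply_univ, Real.volume_Icc, h,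
    smul_eq_mul]
  rw [ENNReal.ofReal_ofNat]
  exact ENNReal.inv_mul_cancel (by norm_num) (by norm_num)

/-- The uniform measure `μ` on `U`: the infinite product of the measures `λ/2` on `[-1,1]`
(as a measure on `ℝ^ℕ` carried by `U`). -/
def unifCube : Measure (ℕ → ℝ) := Measure.infinitePi fun _ => unif

/-- The real function on `U` obtained by restricting `f`. -/
def realRestr (f : (ℕ → ℂ) → ℂ) : (ℕ → ℝ) → ℝ := fun x => (f (toC x)).re

/-- `f` restricts to a positive probability density with respect to `μ` on `U`. -/
structure IsDensityOnCube (f : (ℕ → ℂ) → ℂ) : Prop where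
  real : ∀ x ∈ cube, (f (toC x)).im = 0
  pos : ∀ x ∈ cube, 0 < (f (toC x)).re
  integrable : Integrable (realRestr f) unifCube
  integral_eq_one : ∫ x, realRestr f x ∂unifCube = 1

/-- The marginal `f̂_n(x) = ∫_U f(x, t) μ(dt)` in the first `n` variables.
For `n = 0` this is the total mass, i.e. `1` for a probability density. -/
def marginal (f : (ℕ → ℝ) → ℝ) (n : ℕ) (x : Fin n → ℝ) : ℝ :=
  ∫ t, f (concat x t) ∂unifCube

/-- The conditional density `f̂_{n+1}(x, s) / f̂_n(x)` of the variable number `n` (counted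
from `0`), given the previous ones. -/
def condDensity (f : (ℕ → ℝ) → ℝ) (n : ℕ) (x : Fin n → ℝ) (s : ℝ) : ℝ :=
  marginal f (n + 1) (Fin.snoc x s) / marginal f n x

/-- The distribution function `s ↦ ∫_{-1}^s f_n(x, t) dt/2` of the conditional density. -/
def condCDF (f : (ℕ → ℝ) → ℝ) (n : ℕ) (x : Fin n → ℝ) (s : ℝ) : ℝ :=
  ∫ t in (-1 : ℝ)..s, condDensity f n x t / 2

/-- The first `n` components of the Knothe–Rosenblatt transport `T` from the density `f` to
the density `g`, as a function of the first `n` variables: the new component is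
`G(T_0, …, T_{n-1}, ·)⁻¹ (F(x_0, …, x_{n-1}, x_n))`, where `F`, `G` are the conditional
distribution functions and the inverse is that of a map on `[-1,1]`. -/
def transport (f g : (ℕ → ℝ) → ℝ) : (n : ℕ) → (Fin n → ℝ) → (Fin n → ℝ)
  | 0, x => x
  | n + 1, x =>
      Fin.snoc (transport f g n (Fin.init x))
        (Function.invFunOn (condCDF g n (transport f g n (Fin.init x))) (Set.Icc (-1) 1)
          (condCDF f n (Fin.init x) (x (Fin.last n))))

/-- The component of the transport with number `j` (counted from `0`), a function of the
variables `x_0, …, x_j`. -/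
def transportComp (f g : (ℕ → ℝ) → ℝ) (j : ℕ) (x : Fin (j + 1) → ℝ) : ℝ :=
  transport f g (j + 1) x (Fin.last j)

/-- The assumptions on a density, for given `M`, `L`, smallness constant `C` and `δ`. -/
structure Admissible (M L C : ℝ) {k : ℕ} (δ : Fin k → ℝ) (f : (ℕ → ℂ) → ℂ) : Prop where
  continuousOn : ContinuousOn f (nbhdBoxTimesCube δ)
  density : IsDensityOnCube f
  holomorphic : ∀ y ∈ cube,
    DifferentiableOn ℂ (fun z : Fin k → ℂ => f (concat z (toC y))) (nbhdBox δ)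
  lower : ∀ w ∈ nbhdBoxTimesCube δ, M ≤ ‖f w‖
  upper : ∀ w ∈ nbhdBoxTimesCube δ, ‖f w‖ ≤ L
  small : ∀ x ∈ cube, ∀ y ∈ discBoxTimesZero δ k, ‖f (toC x + y) - f (toC x)‖ ≤ C
  small_next : ∀ j : ℕ, 1 ≤ j → ∀ hj : j < k, ∀ x ∈ cube, ∀ y ∈ discBoxTimesZero δ j,
    ‖f (toC x + y) - f (toC x)‖ ≤ C * δ ⟨j, hj⟩

/-- `R` extends the partial derivative `∂_{x_j} T_j`, defined on the real cube `[-1,1]^{j+1}`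
(one-sided derivative where `x_j = ±1`), for a function `T_j` of `x_0, …, x_j`. -/
def ExtendsLastPartial {j : ℕ} (T : (Fin (j + 1) → ℝ) → ℝ) (R : (Fin (j + 1) → ℂ) → ℂ) :
    Prop :=
  ∀ x : Fin (j + 1) → ℝ, (∀ i, x i ∈ Set.Icc (-1 : ℝ) 1) →
    ∃ r : ℝ, R (toC x) = (r : ℂ) ∧
      HasDerivWithinAt (fun t : ℝ => T (Function.update x (Fin.last j) t)) r
        (Set.Icc (-1) 1) (x (Fin.last j))

end KnotheRosenblatt

end

noncomputable section

namespace KnotheRosenblatt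

open Set Filter Topology Metric

/-! Write F, G for the conditional distribution functions of the two densities. Wherever the complex
equation G(T_0, …, T_{n-1}, T_n) = F(x_0, …, x_n) can be solved for T_n, differentiating it in x_n
gives ∂T_n = f_n(x) / g_n(T(x)), a quotient of conditional densities. So it suffices to continue T
to complex arguments and to control conditional densities there.

Smallness of the perturbation keeps complex marginals near real ones, which lie in [M, L]. Complex
conditional densities are therefore holomorphic and within M/(4L) of the interval [M/L, L/M]
(`Admissible.exists_complexCondDensity_near`). Being half-integrals of these, the distribution
functions are bi-Lipschitz in their last variable, with constants depending on M, L only, hence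
invertible there (`Admissible.complexCondCDF_approx`).

The danger is that the error of T grows with the number of components. `small_next` prevents this:
moving the earlier variables anywhere inside their discs changes F_n and G_n by at most a constant
times C · min(1, d_n), an error measured on the scale of the next variable. Solving near the real
solution then gives |T_i(z) - T_i(x)| ≤ d_i / 4 with no loss in n
(`norm_complexTransport_sub_transport_le`). Holomorphy of T follows by an implicit function argument
(`differentiableOn_complexTransport`).

The bounds on ∂T_n follow since numerator and denominator stay near the positive axis
(`le_re_div_of_near`). For the bound of order 1/d_n: a conditional density has mean 1, also for
complex conditioning variables, and by Cauchy's estimate its oscillation near [-1,1] is of order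
1/d_n (`Admissible.norm_complexCondDensity_sub_one_le`). -/

/-! ### Complex analysis: parametric integrals, primitives, inversion -/

/-- A bounded holomorphic function on a ball is Lipschitz at the centre. -/
lemma norm_sub_le_of_differentiableOn_ball {E : Type*} [NormedAddCommGroup E] [NormedSpace ℂ E]
    {F : E → ℂ} {c z : E} {r B : ℝ} (hd : DifferentiableOn ℂ F (ball c r))
    (hB : ∀ w ∈ ball c r, ‖F w‖ ≤ B) (hz : z ∈ ball c r) :
    ‖F z - F c‖ ≤ 2 * B / r * ‖z - c‖ := by
  have hr : 0 < r := nonempty_ball.1 ⟨z, hz⟩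
  have := Complex.dist_le_div_mul_dist_of_mapsTo_ball (R₂ := 2 * B) hd (fun w hw => by
    rw [mem_closedBall, dist_eq_norm]
    have h1 := hB w hw
    have h2 := hB c (mem_ball_self hr)
    exact (norm_sub_le _ _).trans (by linarith)) hz
  simpa [dist_eq_norm] using this

/-- Holomorphic dependence of a parametric integral, for uniformly bounded integrands. -/
lemma differentiableOn_integral_of_bounded {α : Type*} [MeasurableSpace α] {μ : Measure α}
    [IsFiniteMeasure μ] {n : ℕ} {s : Set (Fin n → ℂ)} (hs : IsOpen s)
    {F : (Fin n → ℂ) → α → ℂ} {B : ℝ}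
    (hmeas : ∀ z ∈ s, AEStronglyMeasurable (F z) μ)
    (hdiff : ∀ᵐ a ∂μ, DifferentiableOn ℂ (fun z => F z a) s)
    (hB : ∀ᵐ a ∂μ, ∀ z ∈ s, ‖F z a‖ ≤ B) :
    DifferentiableOn ℂ (fun z => ∫ a, F z a ∂μ) s := by
  intro z₀ hz₀
  obtain ⟨r, hr, hball⟩ := Metric.isOpen_iff.1 hs z₀ hz₀
  have hder : ∀ᵐ a ∂μ, HasFDerivAt (fun z => F z a) (fderiv ℂ (fun z => F z a) z₀) z₀ := by
    filter_upwards [hdiff] with a ha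
    exact ((ha z₀ hz₀).differentiableAt (hs.mem_nhds hz₀)).hasFDerivAt
  -- Measurability of the derivative in the parameter: each directional derivative is an almost
  -- everywhere limit of measurable difference quotients along a sequence.
  have hcomp : ∀ v : Fin n → ℂ,
      AEStronglyMeasurable (fun a => fderiv ℂ (fun z => F z a) z₀ v) μ := by
    intro v
    have hev : ∀ᶠ t : ℂ in 𝓝[≠] 0, z₀ + t • v ∈ s := by
      have hc : ContinuousAt (fun t : ℂ => z₀ + t • v) 0 := by fun_prop
      have : ∀ᶠ t : ℂ in 𝓝 0, z₀ + t • v ∈ s := hc.eventually_mem (by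
        simpa using hs.mem_nhds hz₀)
      exact this.filter_mono nhdsWithin_le_nhds
    obtain ⟨u, hu⟩ := (𝓝[≠] (0 : ℂ)).exists_seq_tendsto
    obtain ⟨N, hN⟩ := (hu.eventually hev).exists_forall_of_atTop
    have hu' := (tendsto_add_atTop_iff_nat N).2 hu
    refine aestronglyMeasurable_of_tendsto_ae atTop
      (f := fun m a => (u (m + N))⁻¹ • (F (z₀ + u (m + N) • v) a - F z₀ a))
      (fun m => ((hmeas _ (hN _ (Nat.le_add_left N m))).sub (hmeas _ hz₀)).const_smul (u (m + N))⁻¹) ?_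
    filter_upwards [hder] with a ha
    have h1 : HasDerivAt (fun t : ℂ => F (z₀ + t • v) a)
        (fderiv ℂ (fun z => F z a) z₀ v) 0 := ha.hasLineDerivAt v
    have h2 := hasDerivAt_iff_tendsto_slope_zero.1 h1
    have h3 := h2.comp hu'
    simpa [Function.comp_def] using h3
  have hF' : AEStronglyMeasurable (fun a => fderiv ℂ (fun z => F z a) z₀) μ := by
    have : (fun a => fderiv ℂ (fun z => F z a) z₀) = fun a => ∑ i : Fin n,
        (fderiv ℂ (fun z => F z a) z₀ (Pi.single i 1)) •
          (ContinuousLinearMap.proj i : (Fin n → ℂ) →L[ℂ] ℂ) := by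
      funext a
      ext v
      simp only [_root_.sum_apply, _root_.smul_apply,
        ContinuousLinearMap.proj_apply, smul_eq_mul]
      conv_lhs => rw [pi_eq_sum_univ' v]
      simp [map_sum, mul_comm]
    rw [this]
    exact Finset.aestronglyMeasurable_fun_sum _ fun i _ => (hcomp _).smul_const _
  -- Boundedness alone supplies the dominating Lipschitz constant `2 * B / r`, by the previous lemma
  -- on a ball of radius `r`.
  have := (hasFDerivAt_integral_of_dominated_loc_of_lip' (bound := fun _ => 2 * B / r)
    (ball_mem_nhds z₀ hr) (fun z hz => hmeas z (hball hz))
    (Integrable.of_bound (hmeas z₀ hz₀) B (hB.mono fun a ha => ha z₀ hz₀)) hF'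
    (by
      filter_upwards [hB, hdiff] with a ha hda z hz
      exact norm_sub_le_of_differentiableOn_ball (hda.mono hball)
        (fun w hw => ha w (hball hw)) hz)
    (integrable_const _) hder).2
  exact this.differentiableAt.differentiableWithinAt

/-- The integral of a holomorphic function along segments issuing from a base point of a convex
open set is a primitive. -/
lemma hasDerivAt_mul_integral_segment {s : Set ℂ} (hs : Convex ℝ s) (ho : IsOpen s) {g : ℂ → ℂ}
    (hg : DifferentiableOn ℂ g s) {a w : ℂ} (ha : a ∈ s) (hw : w ∈ s) :
    HasDerivAt (fun w => (w - a) * ∫ t in (0 : ℝ)..1, g (a + t * (w - a))) (g w) w := by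
  obtain ⟨G, hG⟩ := hs.exists_forall_hasDerivWithinAt hg
  have hG' : ∀ w ∈ s, HasDerivAt G (g w) w := fun w hw => (hG w hw).hasDerivAt (ho.mem_nhds hw)
  have key : ∀ w ∈ s, (w - a) * ∫ t in (0 : ℝ)..1, g (a + t * (w - a)) = G w - G a := by
    intro w hw
    have hmem : ∀ t ∈ Icc (0 : ℝ) 1, a + t * (w - a) ∈ s := by
      intro t ht
      have := hs.add_smul_sub_mem ha hw ht
      simpa using this
    have hd : ∀ t ∈ uIcc (0 : ℝ) 1,
        HasDerivAt (fun t : ℝ => G (a + t * (w - a))) ((w - a) * g (a + t * (w - a))) t := by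
      intro t ht
      rw [uIcc_of_le zero_le_one] at ht
      have h1 : HasDerivAt (fun t : ℂ => a + t * (w - a)) (w - a) (t : ℂ) := by
        simpa using ((hasDerivAt_id (t : ℂ)).mul_const (w - a)).const_add a
      have h2 := ((hG' _ (hmem t ht)).comp (t : ℂ) h1).comp_ofReal
      simpa [Function.comp_def, mul_comm] using h2
    have hc : ContinuousOn (fun t : ℝ => (w - a) * g (a + t * (w - a))) (uIcc 0 1) := by
      rw [uIcc_of_le zero_le_one]
      refine continuousOn_const.mul (hg.continuousOn.comp ?_ hmem)
      fun_prop
    rw [← intervalIntegral.integral_const_mul,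
      intervalIntegral.integral_eq_sub_of_hasDerivAt hd hc.intervalIntegrable]
    simp
  refine ((hG' w hw).sub_const (G a)).congr_of_eventuallyEq ?_
  filter_upwards [ho.mem_nhds hw] with v hv using key v hv

/-- A solution `w` of `H (z, w z) = 0` is differentiable as soon as `H` is, and is
bounded below in its second variable. -/
lemma differentiableAt_of_implicit {E : Type*} [NormedAddCommGroup E] [NormedSpace ℂ E]
    {H : E × ℂ → ℂ} {w : E → ℂ} {z₀ : E} {c : ℝ} (hc : 0 < c)
    (hH : DifferentiableAt ℂ H (z₀, w z₀))
    (hw : ∀ᶠ z in 𝓝 z₀, H (z, w z) = 0)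
    (hlow : ∀ᶠ z in 𝓝 z₀, c * ‖w z - w z₀‖ ≤ ‖H (z, w z) - H (z, w z₀)‖)
    {d : ℂ} (hd : d ≠ 0) (hHd : HasDerivAt (fun u => H (z₀, u)) d (w z₀)) :
    DifferentiableAt ℂ w z₀ := by
  obtain ⟨D, hD⟩ := hH
  have h0 : H (z₀, w z₀) = 0 := hw.self_of_nhds
  have hDd : ∀ u : ℂ, D (0, u) = d * u := by
    intro u
    have h1 : HasDerivAt (fun u : ℂ => (z₀, u)) ((0 : E), (1 : ℂ)) (w z₀) :=
      (hasDerivAt_const _ _).prodMk (hasDerivAt_id _)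
    have h2 := (HasFDerivAt.comp_hasDerivAt (w z₀) hD h1).unique hHd
    rw [← h2, mul_comm, ← smul_eq_mul, ← map_smul]
    simp
  -- The solution `w` is given, so only its regularity is at stake. The lower bound gives c‖w z - w
  -- z₀‖ ≤ ‖H (z, w z₀)‖, and H (·, w z₀) vanishes at z₀ and is differentiable there; hence `w` is
  -- Lipschitz at z₀.
  have hO : (fun z => w z - w z₀) =O[𝓝 z₀] fun z => z - z₀ := by
    have h1 : (fun z => H (z, w z₀) - H (z₀, w z₀)) =O[𝓝 z₀] fun z => z - z₀ := by
      have : HasFDerivAt (fun z => H (z, w z₀)) (D.comp (ContinuousLinearMap.inl ℂ E ℂ)) z₀ :=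
        HasFDerivAt.comp z₀ hD ((hasFDerivAt_id z₀).prodMk (hasFDerivAt_const _ _))
      exact this.isBigO_sub
    refine (Asymptotics.IsBigO.of_bound c⁻¹ ?_).trans h1
    filter_upwards [hw, hlow] with z hz hl
    rw [hz, zero_sub, norm_neg] at hl
    rw [h0, sub_zero, ← div_eq_inv_mul, le_div_iff₀ hc]
    linarith
  have hcont : Tendsto (fun z => (z, w z)) (𝓝 z₀) (𝓝 (z₀, w z₀)) := by
    refine tendsto_id.prodMk_nhds ?_
    have : Tendsto (fun z => w z - w z₀) (𝓝 z₀) (𝓝 0) := hO.trans_tendsto (by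
      have : ContinuousAt (fun z => z - z₀) z₀ := by fun_prop
      simpa [ContinuousAt] using this)
    simpa using this.add_const (w z₀)
  have hlit := (hasFDerivAt_iff_isLittleO.1 hD).comp_tendsto hcont
  have hlit2 : (fun z => H (z, w z) - H (z₀, w z₀) - D ((z, w z) - (z₀, w z₀)))
      =o[𝓝 z₀] fun z => z - z₀ := by
    refine hlit.trans_isBigO ?_
    exact Asymptotics.IsBigO.prod_left (Asymptotics.isBigO_refl _ _) hO
  -- The usual implicit derivative -(∂_u H)⁻¹ ∂_z H.
  refine ⟨-(d⁻¹ • D.comp (ContinuousLinearMap.inl ℂ E ℂ)), hasFDerivAt_iff_isLittleO.2 ?_⟩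
  refine (hlit2.const_mul_left (-d⁻¹)).congr' ?_ EventuallyEq.rfl
  filter_upwards [hw] with z hz
  have : D ((z, w z) - (z₀, w z₀)) = D (z - z₀, 0) + d * (w z - w z₀) := by
    rw [← hDd, ← map_add]; simp
  rw [hz, h0, this]
  simp only [_root_.neg_apply, _root_.smul_apply,
    ContinuousLinearMap.comp_apply, ContinuousLinearMap.inl_apply, smul_eq_mul]
  field_simp
  ring

/-- A holomorphic function whose derivative stays close to a positive number is bi-Lipschitz on
convex sets. -/
lemma approximatesLinearOn_of_deriv_near {s : Set ℂ} (hs : Convex ℝ s) {G g : ℂ → ℂ}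
    {b : ℂ} {κ : NNReal} (hG : ∀ w ∈ s, HasDerivAt G (g w) w)
    (hg : ∀ w ∈ s, ‖g w - b‖ ≤ κ) :
    ∀ u ∈ s, ∀ v ∈ s, ‖G u - G v - b * (u - v)‖ ≤ κ * ‖u - v‖ := by
  intro u hu v hv
  have := hs.norm_image_sub_le_of_norm_hasDerivWithin_le (f := fun w => G w - b * w)
    (f' := fun w => g w - b) (C := κ)
    (fun w hw => ((hG w hw).sub (by simpa using (hasDerivAt_id w).const_mul b)).hasDerivWithinAt)
    hg hv hu
  have e : G u - G v - b * (u - v) = G u - b * u - (G v - b * v) := by ring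
  rw [e]
  exact this

lemma norm_sub_ge_of_approx {G : ℂ → ℂ} {b κ : ℝ} (hb : 0 ≤ b) {u v : ℂ}
    (h : ‖G u - G v - b * (u - v)‖ ≤ κ * ‖u - v‖) :
    (b - κ) * ‖u - v‖ ≤ ‖G u - G v‖ := by
  have h1 : ‖(b : ℂ) * (u - v)‖ = b * ‖u - v‖ := by
    rw [norm_mul, Complex.norm_real, Real.norm_of_nonneg hb]
  have h2 := norm_sub_norm_le ((b : ℂ) * (u - v)) (G u - G v)
  rw [norm_sub_rev ((b : ℂ) * (u - v))] at h2
  linarith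

/-- Quantitative surjectivity of a Lipschitz perturbation of multiplication by `b`, whose inverse
has norm b⁻¹: a ball of radius `r` covers one of radius (b - κ) r. The explicit radius is needed to
solve the transport equation with constants independent of the dimension. -/
lemma exists_mem_closedBall_eq_of_approx {s : Set ℂ} {G : ℂ → ℂ} {b : ℝ} {κ : NNReal} (hb : 0 < b)
    (h : ∀ u ∈ s, ∀ v ∈ s, ‖G u - G v - b * (u - v)‖ ≤ κ * ‖u - v‖)
    {y₀ u : ℂ} {r : ℝ} (hr : 0 ≤ r) (hball : closedBall y₀ r ⊆ s)
    (hu : ‖u - G y₀‖ ≤ (b - κ) * r) : ∃ w ∈ closedBall y₀ r, G w = u := by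
  have hb' : (b : ℂ) ≠ 0 := by exact_mod_cast hb.ne'
  let f' : ℂ →L[ℂ] ℂ := (b : ℂ) • ContinuousLinearMap.id ℂ ℂ
  have happ : ApproximatesLinearOn G f' s κ := by
    intro x hx y hy
    simpa [f'] using h x hx y hy
  let e : f'.NonlinearRightInverse :=
    { toFun := fun y => (b : ℂ)⁻¹ * y
      nnnorm := ⟨b⁻¹, by positivity⟩
      bound' := fun y => by
        rw [norm_mul, norm_inv, Complex.norm_real, Real.norm_of_nonneg hb.le]; rfl
      right_inv' := fun y => by simp [f', hb'] }
  have := happ.surjOn_closedBall_of_nonlinearRightInverse e hr hball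
  have hmem : u ∈ closedBall (G y₀) ((((e.nnnorm : NNReal) : ℝ)⁻¹ - κ) * r) := by
    rw [mem_closedBall, dist_eq_norm]
    change _ ≤ ((b⁻¹)⁻¹ - (κ : ℝ)) * r
    rwa [inv_inv]
  obtain ⟨w, hw, hwe⟩ := this hmem
  exact ⟨w, hw, hwe⟩

/-! ### Neighbourhoods of the cube and coordinates -/

lemma mem_thickening_realSeg {r : ℝ} {z : ℂ} :
    z ∈ thickening r realSeg ↔ ∃ x ∈ Icc (-1 : ℝ) 1, ‖z - x‖ < r := by
  simp [mem_thickening_iff, realSeg, dist_eq_norm]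

lemma ofReal_mem_thickening {r x : ℝ} (hr : 0 < r) (hx : x ∈ Icc (-1 : ℝ) 1) :
    (x : ℂ) ∈ thickening r realSeg :=
  mem_thickening_realSeg.2 ⟨x, hx, by simpa using hr⟩

lemma convex_thickening_realSeg (r : ℝ) : Convex ℝ (thickening r realSeg) :=
  ((convex_Icc (-1 : ℝ) 1).is_linear_image Complex.ofRealCLM.toLinearMap.isLinear).thickening r

lemma isOpen_nbhdBox {n : ℕ} (ρ : Fin n → ℝ) : IsOpen (nbhdBox ρ) := by
  have : nbhdBox ρ = Set.pi univ fun i => thickening (ρ i) realSeg := by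
    ext; simp [nbhdBox]
  rw [this]
  exact isOpen_set_pi finite_univ fun i _ => isOpen_thickening

/-- Points of the complex neighbourhood of the cube, together with a nearby real point. -/
lemma exists_real_near_of_mem_nbhdBox {n : ℕ} {ρ : Fin n → ℝ} {z : Fin n → ℂ}
    (hz : z ∈ nbhdBox ρ) :
    ∃ x : Fin n → ℝ, (∀ i, x i ∈ Icc (-1 : ℝ) 1) ∧ ∀ i, ‖z i - x i‖ < ρ i := by
  choose x hx hzx using fun i => mem_thickening_realSeg.1 (hz i)
  exact ⟨x, hx, hzx⟩

lemma mem_nbhdBox_of_near {n : ℕ} {ρ : Fin n → ℝ} {z : Fin n → ℂ} {x : Fin n → ℝ}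
    (hx : ∀ i, x i ∈ Icc (-1 : ℝ) 1) (h : ∀ i, ‖z i - x i‖ < ρ i) : z ∈ nbhdBox ρ :=
  fun i => mem_thickening_realSeg.2 ⟨x i, hx i, h i⟩

lemma toC_mem_nbhdBox {n : ℕ} {ρ : Fin n → ℝ} (hρ : ∀ i, 0 < ρ i) {x : Fin n → ℝ}
    (hx : ∀ i, x i ∈ Icc (-1 : ℝ) 1) : toC x ∈ nbhdBox ρ :=
  mem_nbhdBox_of_near hx fun i => by simpa [toC] using hρ i

lemma snoc_mem_nbhdBox {n : ℕ} {d : ℕ → ℝ} {z : Fin n → ℂ} {s : ℂ}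
    (hz : z ∈ nbhdBox fun i : Fin n => d i) (hs : s ∈ thickening (d n) realSeg) :
    Fin.snoc (α := fun _ => ℂ) z s ∈ nbhdBox fun i : Fin (n + 1) => d i := by
  intro i
  refine Fin.lastCases ?_ (fun i => ?_) i
  · simpa using hs
  · simpa using hz i

lemma init_mem_nbhdBox {n : ℕ} {d : ℕ → ℝ} {z : Fin (n + 1) → ℂ}
    (hz : z ∈ nbhdBox fun i : Fin (n + 1) => d i) :
    Fin.init z ∈ nbhdBox fun i : Fin n => d i :=
  fun i => hz i.castSucc

lemma toC_snoc {n : ℕ} (x : Fin n → ℝ) (s : ℝ) :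
    toC (Fin.snoc (α := fun _ => ℝ) x s) = Fin.snoc (α := fun _ => ℂ) (toC x) (s : ℂ) := by
  funext i
  refine Fin.lastCases ?_ (fun i => ?_) i <;> simp [toC]

lemma toC_concat {n : ℕ} (x : Fin n → ℝ) (t : ℕ → ℝ) :
    toC (concat x t) = concat (toC x) (toC t) := by
  funext i
  simp only [toC, concat]
  split_ifs <;> rfl

lemma concat_mem_cube {n : ℕ} {x : Fin n → ℝ} (hx : ∀ i, x i ∈ Icc (-1 : ℝ) 1)
    {t : ℕ → ℝ} (ht : t ∈ cube) : concat x t ∈ cube := by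
  intro i
  simp only [concat]
  split_ifs
  · exact hx _
  · exact ht _

lemma snoc_mem_Icc {n : ℕ} {x : Fin n → ℝ} {s : ℝ} (hx : ∀ i, x i ∈ Icc (-1 : ℝ) 1)
    (hs : s ∈ Icc (-1 : ℝ) 1) :
    ∀ i, Fin.snoc (α := fun _ => ℝ) x s i ∈ Icc (-1 : ℝ) 1 := by
  intro i
  refine Fin.lastCases ?_ (fun i => ?_) i
  · simpa using hs
  · simpa using hx i

lemma concat_snoc {α : Type*} {n : ℕ} (z : Fin n → α) (s : α) (t : ℕ → α) :
    concat (Fin.snoc (α := fun _ => α) z s) t =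
      concat z (fun i => Nat.casesOn i s t) := by
  funext i
  simp only [concat]
  rcases lt_trichotomy i n with h | rfl | h
  · rw [dif_pos (by omega), dif_pos h]
    exact Fin.snoc_castSucc (α := fun _ => α) (x := s) (p := z) ⟨i, h⟩
  · rw [dif_pos (by omega), dif_neg (by omega)]
    simp only [Nat.sub_self]
    exact Fin.snoc_last (α := fun _ => α) s z
  · rw [dif_neg (by omega), dif_neg (by omega)]
    obtain ⟨m, rfl⟩ := Nat.exists_eq_add_of_lt h
    have h1 : n + m + 1 - (n + 1) = m := by omega
    have h2 : n + m + 1 - n = m + 1 := by omega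
    rw [h1, h2]

lemma continuous_concat_toC {n : ℕ} :
    Continuous fun p : (Fin n → ℂ) × (ℕ → ℝ) => concat p.1 (toC p.2) := by
  refine continuous_pi fun i => ?_
  simp only [concat, toC]
  split_ifs <;> fun_prop

lemma isClosed_cube : IsClosed cube := by
  have : cube = Set.pi univ fun _ : ℕ => Icc (-1 : ℝ) 1 := by ext; simp only [cube, Set.mem_pi, mem_univ, true_imp_iff]; rfl
  rw [this]
  exact isClosed_set_pi fun i _ => isClosed_Icc

/-! ### The uniform measures -/

instance : IsProbabilityMeasure unifCube := by unfold unifCube; infer_instance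

lemma ae_unif_mem_Icc : ∀ᵐ s ∂unif, s ∈ Icc (-1 : ℝ) 1 := by
  refine Measure.ae_smul_measure ?_ _
  exact ae_restrict_mem measurableSet_Icc

lemma ae_unifCube_mem_cube : ∀ᵐ t ∂unifCube, t ∈ cube := by
  refine ae_all_iff.2 fun i => ?_
  exact (measurePreserving_eval_infinitePi (fun _ : ℕ => unif) i).quasiMeasurePreserving.ae
    ae_unif_mem_Icc

lemma integral_unif {E : Type*} [NormedAddCommGroup E] [NormedSpace ℝ E] (h : ℝ → E) :
    ∫ s, h s ∂unif = (2 : ℝ)⁻¹ • ∫ s in (-1 : ℝ)..1, h s := by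
  rw [unif, integral_smul_measure, intervalIntegral.integral_of_le (by norm_num),
    integral_Icc_eq_integral_Ioc]
  simp

/-- Prepending an independent uniform variable to a uniform point of the cube gives a uniform
point of the cube. -/
lemma measurePreserving_cons :
    MeasurePreserving (fun p : ℝ × (ℕ → ℝ) => (fun i => Nat.casesOn i p.1 p.2 : ℕ → ℝ))
      (unif.prod unifCube) unifCube := by
  have hm : Measurable (fun p : ℝ × (ℕ → ℝ) => (fun i => Nat.casesOn i p.1 p.2 : ℕ → ℝ)) := by
    refine measurable_pi_lambda _ fun i => ?_
    cases i <;> simp only <;> fun_prop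
  refine ⟨hm, ?_⟩
  refine Measure.eq_infinitePi _ fun s t ht => ?_
  classical
  obtain ⟨N, hN⟩ := s.exists_nat_subset_range
  -- Padding with the whole line turns a box over an arbitrary finite index set into one over an
  -- initial segment, where coordinate 0 splits off.
  let t' : ℕ → Set ℝ := fun i => if i ∈ s then t i else univ
  have ht' : ∀ i, MeasurableSet (t' i) := fun i => by
    simp only [t']; split_ifs; exacts [ht i, .univ]
  have hpre : (fun p : ℝ × (ℕ → ℝ) => (fun i => Nat.casesOn i p.1 p.2 : ℕ → ℝ)) ⁻¹'
      (Set.pi s t) = t' 0 ×ˢ Set.pi (Finset.range N) (fun i => t' (i + 1)) := by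
    ext ⟨a, y⟩
    simp only [mem_preimage, Set.mem_pi, SetLike.mem_coe, mem_prod, Finset.mem_range, t']
    constructor
    · intro h
      refine ⟨?_, fun i _ => ?_⟩
      · split_ifs with h0
        · exact h 0 h0
        · trivial
      · split_ifs with h0
        · exact h (i + 1) h0
        · trivial
    · rintro ⟨h0, h1⟩ i hi
      cases i with
      | zero => simpa [hi] using h0
      | succ i =>
        have := h1 i (by have := Finset.mem_range.1 (hN hi); omega)
        simpa [hi] using this
  have hprod : ∏ i ∈ s, unif (t i) = ∏ i ∈ Finset.range (N + 1), unif (t' i) := by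
    have hsub : s ⊆ Finset.range (N + 1) :=
      hN.trans (Finset.range_subset_range.2 (Nat.le_succ N))
    rw [← Finset.prod_subset hsub]
    · exact Finset.prod_congr rfl fun i hi => by simp [t', hi]
    · intro i _ hi
      simp [t', hi]
  rw [Measure.map_apply hm (MeasurableSet.pi s.countable_toSet fun i _ => ht i), hpre,
    Measure.prod_prod, hprod, Finset.prod_range_succ', mul_comm]
  congr 1
  exact Measure.infinitePi_pi _ fun i _ => ht' _

/-! ### Complex marginals -/

/-- The marginal of a density in its first `n` complex variables. -/
def complexMarginal (f : (ℕ → ℂ) → ℂ) (n : ℕ) (z : Fin n → ℂ) : ℂ :=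
  ∫ t, f (concat z (toC t)) ∂unifCube

section Marginal

variable {M L C : ℝ} {k : ℕ} {d : ℕ → ℝ} {f : (ℕ → ℂ) → ℂ}

lemma concat_mem_nbhdBoxTimesCube (hd : ∀ i, 0 < d i) {n : ℕ} (hn : n ≤ k) {z : Fin n → ℂ}
    (hz : z ∈ nbhdBox fun i : Fin n => d i) {t : ℕ → ℝ} (ht : t ∈ cube) :
    concat z (toC t) ∈ nbhdBoxTimesCube fun i : Fin k => d i := by
  constructor
  · intro i
    simp only [concat]
    split_ifs with h
    · exact hz ⟨i, h⟩
    · exact ofReal_mem_thickening (hd i) (ht _)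
  · intro i hi
    simp only [concat]
    rw [dif_neg (by omega)]
    exact ⟨_, ht _, rfl⟩

lemma Admissible.aestronglyMeasurable (hd : ∀ i, 0 < d i)
    (hf : Admissible M L C (fun i : Fin k => d i) f) {n : ℕ} (hn : n ≤ k) {z : Fin n → ℂ}
    (hz : z ∈ nbhdBox fun i : Fin n => d i) :
    AEStronglyMeasurable (fun t => f (concat z (toC t))) unifCube := by
  have h1 : ContinuousOn (fun t : ℕ → ℝ => f (concat z (toC t))) cube := by
    refine hf.continuousOn.comp ?_ fun t ht => concat_mem_nbhdBoxTimesCube hd hn hz ht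
    exact (continuous_concat_toC.comp (Continuous.prodMk_right z)).continuousOn
  have h2 := h1.aestronglyMeasurable (μ := unifCube) isClosed_cube.measurableSet
  rwa [Measure.restrict_eq_self_of_ae_mem ae_unifCube_mem_cube] at h2

lemma Admissible.integrable (hd : ∀ i, 0 < d i)
    (hf : Admissible M L C (fun i : Fin k => d i) f) {n : ℕ} (hn : n ≤ k) {z : Fin n → ℂ}
    (hz : z ∈ nbhdBox fun i : Fin n => d i) :
    Integrable (fun t => f (concat z (toC t))) unifCube :=
  .of_bound (hf.aestronglyMeasurable hd hn hz) L (ae_unifCube_mem_cube.mono fun _ ht =>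
    hf.upper _ (concat_mem_nbhdBoxTimesCube hd hn hz ht))

lemma Admissible.differentiableOn_concat (hd : ∀ i, 0 < d i)
    (hf : Admissible M L C (fun i : Fin k => d i) f) {n : ℕ} (hn : n ≤ k) {t : ℕ → ℝ}
    (ht : t ∈ cube) :
    DifferentiableOn ℂ (fun z : Fin n → ℂ => f (concat z (toC t)))
      (nbhdBox fun i : Fin n => d i) := by
  -- Holomorphy is assumed for all `k` variables at once; `φ` freezes those from `n` to `k - 1` at
  -- real values, and the remaining tail of `t` is shifted by `k - n`.
  let φ : (Fin n → ℂ) → Fin k → ℂ := fun z i => if h : (i : ℕ) < n then z ⟨i, h⟩ else t (i - n)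
  have hφ : Differentiable ℂ φ := by
    refine differentiable_pi.2 fun i => ?_
    simp only [φ]
    split_ifs <;> fun_prop
  have hmaps : MapsTo φ (nbhdBox fun i : Fin n => d i) (nbhdBox fun i : Fin k => d i) := by
    intro z hz i
    simp only [φ]
    split_ifs with h
    · exact hz ⟨i, h⟩
    · exact ofReal_mem_thickening (hd i) (ht _)
  have heq : (fun z : Fin n → ℂ => f (concat z (toC t))) =
      (fun z : Fin k → ℂ => f (concat z (toC fun i => t (i + (k - n))))) ∘ φ := by
    funext z
    simp only [Function.comp_apply]
    congr 1
    funext i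
    simp only [concat, toC, φ]
    by_cases h : i < n
    · rw [dif_pos h, dif_pos (by omega), dif_pos h]
    · rw [dif_neg h]
      split_ifs with h'
      · rfl
      · congr 2; omega
  rw [heq]
  exact (hf.holomorphic _ fun i => ht _).comp hφ.differentiableOn hmaps

lemma Admissible.differentiableOn_complexMarginal (hd : ∀ i, 0 < d i)
    (hf : Admissible M L C (fun i : Fin k => d i) f) {n : ℕ} (hn : n ≤ k) :
    DifferentiableOn ℂ (complexMarginal f n) (nbhdBox fun i : Fin n => d i) :=
  differentiableOn_integral_of_bounded (isOpen_nbhdBox _)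
    (fun _ hz => hf.aestronglyMeasurable hd hn hz)
    (ae_unifCube_mem_cube.mono fun _ ht => hf.differentiableOn_concat hd hn ht)
    (ae_unifCube_mem_cube.mono fun _ ht _ hz =>
      hf.upper _ (concat_mem_nbhdBoxTimesCube hd hn hz ht))

lemma Admissible.norm_complexMarginal_le (hd : ∀ i, 0 < d i)
    (hf : Admissible M L C (fun i : Fin k => d i) f) {n : ℕ} (hn : n ≤ k) {z : Fin n → ℂ}
    (hz : z ∈ nbhdBox fun i : Fin n => d i) : ‖complexMarginal f n z‖ ≤ L := by
  have := norm_integral_le_of_norm_le_const (μ := unifCube) (ae_unifCube_mem_cube.mono fun _ ht =>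
    hf.upper _ (concat_mem_nbhdBoxTimesCube hd hn hz ht))
  simpa [complexMarginal] using this

/-- Moving only the first `m` variables away from the reals changes the density little. -/
lemma Admissible.norm_apply_sub_le (hd : ∀ i, 0 < d i)
    (hf : Admissible M L C (fun i : Fin k => d i) f) {m : ℕ} (hm : m ≤ k) {x : ℕ → ℝ}
    (hx : x ∈ cube) {y : ℕ → ℂ} (hy : y ∈ discBoxTimesZero (fun i : Fin k => d i) m) :
    ‖f (toC x + y) - f (toC x)‖ ≤ C := by
  refine hf.small x hx y ⟨fun i _ => ?_, fun i hi => hy.2 i (hm.trans hi)⟩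
  by_cases h : (i : ℕ) < m
  · exact hy.1 i h
  · rw [hy.2 i (not_lt.1 h), norm_zero]
    exact hd i

lemma Admissible.norm_apply_sub_le_min (hd : ∀ i, 0 < d i) (hC : 0 ≤ C)
    (hf : Admissible M L C (fun i : Fin k => d i) f) {m : ℕ} (hm : m < k) {x : ℕ → ℝ}
    (hx : x ∈ cube) {y : ℕ → ℂ} (hy : y ∈ discBoxTimesZero (fun i : Fin k => d i) m) :
    ‖f (toC x + y) - f (toC x)‖ ≤ C * min 1 (d m) := by
  rw [mul_min_of_nonneg _ _ hC, mul_one]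
  refine le_min (hf.norm_apply_sub_le hd hm.le hx hy) ?_
  -- `small_next` starts at 1. For m = 0 no variable moves, so the difference vanishes.
  rcases Nat.eq_zero_or_pos m with rfl | h
  · have : y = 0 := funext fun i => hy.2 i (Nat.zero_le _)
    rw [this]
    simpa using mul_nonneg hC (hd 0).le
  · exact hf.small_next m h hm x hx y hy

/-- Integration over the remaining variables preserves a uniform bound. The bound `D` and the number
`m` of variables leaving the reals are kept free, to serve both `small` and `small_next`. -/
lemma Admissible.norm_complexMarginal_sub_le (hd : ∀ i, 0 < d i)
    (hf : Admissible M L C (fun i : Fin k => d i) f) {m n : ℕ} (hn : n ≤ k) {D : ℝ}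
    (hD : ∀ x ∈ cube, ∀ y ∈ discBoxTimesZero (fun i : Fin k => d i) m,
      ‖f (toC x + y) - f (toC x)‖ ≤ D)
    {z : Fin n → ℂ} {x : Fin n → ℝ} (hx : ∀ i, x i ∈ Icc (-1 : ℝ) 1)
    (hz : ∀ i : Fin n, (i : ℕ) < m → ‖z i - x i‖ < d i)
    (hz' : ∀ i : Fin n, m ≤ (i : ℕ) → z i = x i) :
    ‖complexMarginal f n z - complexMarginal f n (toC x)‖ ≤ D := by
  have hzb : z ∈ nbhdBox fun i : Fin n => d i := mem_nbhdBox_of_near hx fun i => by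
    by_cases h : (i : ℕ) < m
    · exact hz i h
    · rw [hz' i (not_lt.1 h), sub_self, norm_zero]; exact hd i
  have hxb : toC x ∈ nbhdBox fun i : Fin n => d i := toC_mem_nbhdBox (fun i => hd i) hx
  unfold complexMarginal
  rw [← integral_sub (hf.integrable hd hn hzb) (hf.integrable hd hn hxb)]
  refine (norm_integral_le_of_norm_le_const (C := D) ?_).trans_eq (by simp)
  filter_upwards [ae_unifCube_mem_cube] with t ht
  have hsum : concat z (toC t) = toC (concat x t) +
      fun i => if h : i < n then z ⟨i, h⟩ - x ⟨i, h⟩ else 0 := by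
    funext i
    simp only [concat, toC, Pi.add_apply]
    split_ifs <;> simp
  rw [← toC_concat, hsum]
  refine hD _ (concat_mem_cube hx ht) _ ⟨fun i hi => ?_, fun i hi => ?_⟩
  · simp only
    split_ifs with h
    · exact hz ⟨i, h⟩ hi
    · rw [norm_zero]; exact hd i
  · simp only
    split_ifs with h
    · rw [hz' ⟨i, h⟩ hi, sub_self]
    · rfl

lemma Admissible.apply_toC (hf : Admissible M L C (fun i : Fin k => d i) f) {x : ℕ → ℝ}
    (hx : x ∈ cube) : f (toC x) = (realRestr f x : ℂ) :=
  Complex.ext (by simp [realRestr]) (by simp [hf.density.real x hx])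

lemma Admissible.realRestr_mem_Icc (hd : ∀ i, 0 < d i)
    (hf : Admissible M L C (fun i : Fin k => d i) f) {x : ℕ → ℝ} (hx : x ∈ cube) :
    realRestr f x ∈ Icc M L := by
  have hmem : toC x ∈ nbhdBoxTimesCube fun i : Fin k => d i :=
    ⟨fun i => ofReal_mem_thickening (hd i) (hx i), fun i _ => ⟨_, hx i, rfl⟩⟩
  have hn : ‖f (toC x)‖ = realRestr f x := by
    rw [hf.apply_toC hx, Complex.norm_real]
    exact Real.norm_of_nonneg (hf.density.pos x hx).le
  exact ⟨hn ▸ hf.lower _ hmem, hn ▸ hf.upper _ hmem⟩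

lemma Admissible.complexMarginal_toC (hf : Admissible M L C (fun i : Fin k => d i) f) {n : ℕ}
    {x : Fin n → ℝ} (hx : ∀ i, x i ∈ Icc (-1 : ℝ) 1) :
    complexMarginal f n (toC x) = (marginal (realRestr f) n x : ℂ) := by
  unfold complexMarginal marginal
  rw [← integral_complex_ofReal]
  refine integral_congr_ae ?_
  filter_upwards [ae_unifCube_mem_cube] with t ht
  rw [← toC_concat, hf.apply_toC (concat_mem_cube hx ht)]

lemma Admissible.marginal_mem_Icc (hd : ∀ i, 0 < d i)
    (hf : Admissible M L C (fun i : Fin k => d i) f) {n : ℕ} (hn : n ≤ k)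
    {x : Fin n → ℝ} (hx : ∀ i, x i ∈ Icc (-1 : ℝ) 1) :
    marginal (realRestr f) n x ∈ Icc M L := by
  have hint : Integrable (fun t => realRestr f (concat x t)) unifCube := by
    have := (hf.integrable hd hn (toC_mem_nbhdBox (fun i => hd i) hx)).re
    refine this.congr ?_
    filter_upwards with t
    rw [← toC_concat]
    rfl
  constructor
  · have := integral_mono_ae (integrable_const M) hint (ae_unifCube_mem_cube.mono fun t ht =>
      (hf.realRestr_mem_Icc hd (concat_mem_cube hx ht)).1)
    simpa [marginal] using this
  · have := integral_mono_ae hint (integrable_const L) (ae_unifCube_mem_cube.mono fun t ht =>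
      (hf.realRestr_mem_Icc hd (concat_mem_cube hx ht)).2)
    simpa [marginal] using this

/-- Fubini, after splitting one coordinate off the cube. It is what gives complex conditional
densities total mass 1. -/
lemma Admissible.complexMarginal_eq_integral (hd : ∀ i, 0 < d i)
    (hf : Admissible M L C (fun i : Fin k => d i) f) {n : ℕ} (hn : n ≤ k) {z : Fin n → ℂ}
    (hz : z ∈ nbhdBox fun i : Fin n => d i) :
    complexMarginal f n z =
      ∫ s, complexMarginal f (n + 1) (Fin.snoc (α := fun _ => ℂ) z (s : ℂ)) ∂unif := by
  have hmp := measurePreserving_cons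
  have hint := hf.integrable hd hn hz
  have e : ∀ p : ℝ × (ℕ → ℝ), toC (fun i => Nat.casesOn i p.1 p.2 : ℕ → ℝ) =
      (fun i => Nat.casesOn i (p.1 : ℂ) (toC p.2) : ℕ → ℂ) := by
    intro p
    funext i
    cases i <;> rfl
  have hint' := (hmp.integrable_comp hint.aestronglyMeasurable).2 hint
  have h1 : complexMarginal f n z =
      ∫ p : ℝ × (ℕ → ℝ), f (concat z (toC (fun i => Nat.casesOn i p.1 p.2 : ℕ → ℝ)))
        ∂(unif.prod unifCube) := by
    unfold complexMarginal
    conv_lhs => rw [← hmp.map_eq]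
    rw [integral_map hmp.aemeasurable (by rw [hmp.map_eq]; exact hint.aestronglyMeasurable)]
  rw [h1]
  refine (integral_prod _ hint').trans ?_
  refine integral_congr_ae (.of_forall fun s => integral_congr_ae (.of_forall fun t => ?_))
  simp only [concat_snoc]
  exact congrArg (fun y => f (concat z y)) (e (s, t))

end Marginal

/-! ### Complex conditional densities and distribution functions -/

/-- The errors of numerator and denominator contribute 2L/M² · D each, the first after enlarging by
L/M ≥ 1. This is the origin of the factor 4L/M² used throughout. -/
lemma norm_div_sub_div_le {M L D : ℝ} (hM : 0 < M) (hML : M ≤ L) {A A₀ B B₀ : ℂ}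
    (hA : ‖A - A₀‖ ≤ D) (hB : ‖B - B₀‖ ≤ D) (hA₀ : ‖A₀‖ ≤ L) (hB₀ : M ≤ ‖B₀‖)
    (hB' : M / 2 ≤ ‖B‖) : ‖A / B - A₀ / B₀‖ ≤ 4 * L / M ^ 2 * D := by
  have hD : 0 ≤ D := (norm_nonneg _).trans hA
  have hL : 0 < L := hM.trans_le hML
  have hBn : 0 < ‖B‖ := lt_of_lt_of_le (by positivity) hB'
  have hBn₀ : 0 < ‖B₀‖ := hM.trans_le hB₀
  have hb : B ≠ 0 := norm_pos_iff.1 hBn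
  have hb₀ : B₀ ≠ 0 := norm_pos_iff.1 hBn₀
  have e : A / B - A₀ / B₀ = (A - A₀) / B - A₀ * (B - B₀) / (B * B₀) := by
    field_simp; ring
  have h1 : ‖(A - A₀) / B‖ ≤ D / (M / 2) := by
    rw [norm_div]; gcongr
  have h2 : ‖A₀ * (B - B₀) / (B * B₀)‖ ≤ L * D / (M / 2 * M) := by
    rw [norm_div, norm_mul, norm_mul]; gcongr
  have h3 : D / (M / 2) ≤ 2 * L / M ^ 2 * D := by
    rw [div_le_iff₀ (by positivity)]
    have : 2 * L / M ^ 2 * D * (M / 2) = L / M * D := by field_simp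
    rw [this]
    have : 1 ≤ L / M := (one_le_div hM).2 hML
    nlinarith
  have h4 : L * D / (M / 2 * M) = 2 * L / M ^ 2 * D := by field_simp
  have h5 : 4 * L / M ^ 2 * D = 2 * L / M ^ 2 * D + 2 * L / M ^ 2 * D := by ring
  rw [e, h5]
  exact (norm_sub_le _ _).trans (add_le_add (h1.trans h3) (h2.trans_eq h4))

/-- The conditional density of the variable number `n`, for complex arguments. -/
def complexCondDensity (f : (ℕ → ℂ) → ℂ) (n : ℕ) (z : Fin n → ℂ) (s : ℂ) : ℂ :=
  complexMarginal f (n + 1) (Fin.snoc (α := fun _ => ℂ) z s) / complexMarginal f n z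

/-- The conditional distribution function, for complex arguments: the integral of half the
conditional density along the segment from `-1` to `s`. -/
def complexCondCDF (f : (ℕ → ℂ) → ℂ) (n : ℕ) (z : Fin n → ℂ) (s : ℂ) : ℂ :=
  (s - (-1)) * ∫ t in (0 : ℝ)..1, complexCondDensity f n z (-1 + t * (s - (-1))) / 2

/-- The smallness required of the perturbation constant `C` for densities with values
between `M` and `L`. -/
structure SmallConst (M L C : ℝ) : Prop where
  M_pos : 0 < M
  M_le_L : M ≤ L
  nonneg : 0 ≤ C
  le_half : C ≤ M / 2
  le_ratio : 4 * L / M ^ 2 * C ≤ M / L / 64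

lemma SmallConst.ratio_pos {M L C : ℝ} (h : SmallConst M L C) : 0 < M / L :=
  div_pos h.M_pos (h.M_pos.trans_le h.M_le_L)

lemma SmallConst.le_quarter {M L C : ℝ} (h : SmallConst M L C) :
    4 * L / M ^ 2 * C ≤ M / L / 4 := by
  linarith [h.le_ratio, h.ratio_pos]

lemma SmallConst.ratio_le {M L C : ℝ} (h : SmallConst M L C) : M / L ≤ L / M := by
  have hL := h.M_pos.trans_le h.M_le_L
  exact ((div_le_one hL).2 h.M_le_L).trans ((one_le_div h.M_pos).2 h.M_le_L)

/-- Used with B = d n to stay inside the domain of the next variable, and with B = 1 to stay at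
distance at most 1 from the reals when d n is large. -/
lemma SmallConst.mul_min_le {M L C r B : ℝ} (h : SmallConst M L C) (hr : min 1 r ≤ B)
    (hB : 0 ≤ B) : 4 * L / M ^ 2 * (C * min 1 r) ≤ M / L / 64 * B := by
  have hL := h.M_pos.trans_le h.M_le_L
  have h0 : 0 ≤ 4 * L / M ^ 2 * C := mul_nonneg (by positivity) h.nonneg
  calc _ = 4 * L / M ^ 2 * C * min 1 r := by ring
    _ ≤ 4 * L / M ^ 2 * C * B := mul_le_mul_of_nonneg_left hr h0
    _ ≤ _ := mul_le_mul_of_nonneg_right h.le_ratio hB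

lemma segment_mem_thickening {r : ℝ} (hr : 0 < r) {s : ℂ} (hs : s ∈ thickening r realSeg) {t : ℝ}
    (ht : t ∈ Icc (0 : ℝ) 1) : -1 + t * (s - (-1)) ∈ thickening r realSeg := by
  have h1 : (-1 : ℂ) ∈ thickening r realSeg := by
    simpa using ofReal_mem_thickening (x := -1) hr (by simp)
  simpa only [Complex.real_smul] using (convex_thickening_realSeg r).add_smul_sub_mem h1 hs ht

section Conditional

variable {M L C : ℝ} {k : ℕ} {d : ℕ → ℝ} {f : (ℕ → ℂ) → ℂ}

/-- A lower bound on |f| could be lost to cancellation in the integral. Instead, the marginal is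
within C ≤ M/2 of a real marginal, which is at least M. -/
lemma Admissible.le_norm_complexMarginal (hc : SmallConst M L C) (hd : ∀ i, 0 < d i)
    (hf : Admissible M L C (fun i : Fin k => d i) f) {n : ℕ} (hn : n ≤ k) {z : Fin n → ℂ}
    (hz : z ∈ nbhdBox fun i : Fin n => d i) : M / 2 ≤ ‖complexMarginal f n z‖ := by
  obtain ⟨x, hx, hzx⟩ := exists_real_near_of_mem_nbhdBox hz
  have h1 := hf.norm_complexMarginal_sub_le hd hn (m := n) (fun x hx y hy => hf.norm_apply_sub_le hd hn hx hy)
    hx (fun i _ => hzx i) (fun i hi => absurd i.isLt (not_lt.2 hi))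
  have h2 : M ≤ ‖complexMarginal f n (toC x)‖ := by
    rw [hf.complexMarginal_toC hx, Complex.norm_real]
    exact (hf.marginal_mem_Icc hd hn hx).1.trans (Real.le_norm_self _)
  have h3 := norm_sub_norm_le (complexMarginal f n (toC x)) (complexMarginal f n z)
  rw [norm_sub_rev] at h3
  linarith [hc.le_half]

lemma Admissible.complexCondDensity_toC (hf : Admissible M L C (fun i : Fin k => d i) f) {n : ℕ}
    {x : Fin n → ℝ} (hx : ∀ i, x i ∈ Icc (-1 : ℝ) 1) {s : ℝ} (hs : s ∈ Icc (-1 : ℝ) 1) :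
    complexCondDensity f n (toC x) s = (condDensity (realRestr f) n x s : ℂ) := by
  rw [complexCondDensity, ← toC_snoc, hf.complexMarginal_toC hx,
    hf.complexMarginal_toC (snoc_mem_Icc hx hs), condDensity, Complex.ofReal_div]

lemma Admissible.condDensity_mem_Icc (hM : 0 < M) (hd : ∀ i, 0 < d i)
    (hf : Admissible M L C (fun i : Fin k => d i) f) {n : ℕ} (hn : n < k)
    {x : Fin n → ℝ} (hx : ∀ i, x i ∈ Icc (-1 : ℝ) 1) {s : ℝ} (hs : s ∈ Icc (-1 : ℝ) 1) :
    condDensity (realRestr f) n x s ∈ Icc (M / L) (L / M) := by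
  have h1 := hf.marginal_mem_Icc hd hn.le hx
  have h2 := hf.marginal_mem_Icc hd (Nat.succ_le_of_lt hn) (snoc_mem_Icc hx hs)
  have h3 : 0 < marginal (realRestr f) n x := hM.trans_le h1.1
  have h4 : 0 < L := h3.trans_le h1.2
  exact ⟨div_le_div₀ (hM.le.trans h2.1) h2.1 h3 h1.2, div_le_div₀ h4.le h2.2 hM h1.1⟩

/-- The conditional density at a complex point is close to the one at a nearby real point. -/
lemma Admissible.norm_complexCondDensity_sub_le_of_bound (hc : SmallConst M L C)
    (hd : ∀ i, 0 < d i) (hf : Admissible M L C (fun i : Fin k => d i) f) {m n : ℕ} (hn : n < k)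
    {D : ℝ} (hD : ∀ x ∈ cube, ∀ y ∈ discBoxTimesZero (fun i : Fin k => d i) m,
      ‖f (toC x + y) - f (toC x)‖ ≤ D)
    {z : Fin n → ℂ} {s : ℂ} {x : Fin n → ℝ} {σ : ℝ} (hx : ∀ i, x i ∈ Icc (-1 : ℝ) 1)
    (hσ : σ ∈ Icc (-1 : ℝ) 1) (hm : n ≤ m) (hz : ∀ i : Fin n, ‖z i - x i‖ < d i)
    (hs : n < m → ‖s - σ‖ < d n) (hs' : m ≤ n → s = σ) :
    ‖complexCondDensity f n z s - complexCondDensity f n (toC x) σ‖ ≤ 4 * L / M ^ 2 * D := by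
  have hzb : z ∈ nbhdBox fun i : Fin n => d i := mem_nbhdBox_of_near hx hz
  have h1 := hf.norm_complexMarginal_sub_le hd hn.le hD hx (fun i _ => hz i)
    (fun i hi => absurd i.isLt (not_lt.2 (hm.trans hi)))
  have h2 := hf.norm_complexMarginal_sub_le hd (Nat.succ_le_of_lt hn) hD (snoc_mem_Icc hx hσ)
    (z := Fin.snoc (α := fun _ => ℂ) z s)
    (fun i hi => by
      revert hi
      refine Fin.lastCases (fun hi => ?_) (fun i hi => ?_) i
      · simpa using hs (by simpa using hi)
      · simpa using hz i)
    (fun i hi => by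
      revert hi
      refine Fin.lastCases (fun hi => ?_) (fun i hi => ?_) i
      · simpa using hs' (by simpa using hi)
      · exact absurd i.isLt (not_lt.2 (hm.trans (by simpa using hi))))
  rw [toC_snoc] at h2
  refine norm_div_sub_div_le hc.M_pos hc.M_le_L h2 h1 ?_ ?_
    (hf.le_norm_complexMarginal hc hd hn.le hzb)
  · rw [← toC_snoc]
    exact hf.norm_complexMarginal_le hd (Nat.succ_le_of_lt hn)
      (toC_mem_nbhdBox (fun i => hd i) (snoc_mem_Icc hx hσ))
  · rw [hf.complexMarginal_toC hx, Complex.norm_real]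
    exact (hf.marginal_mem_Icc hd hn.le hx).1.trans (Real.le_norm_self _)

lemma Admissible.norm_complexCondDensity_sub_le (hc : SmallConst M L C)
    (hd : ∀ i, 0 < d i) (hf : Admissible M L C (fun i : Fin k => d i) f) {n : ℕ} (hn : n < k)
    {z : Fin n → ℂ} {s : ℂ} {x : Fin n → ℝ} {σ : ℝ} (hx : ∀ i, x i ∈ Icc (-1 : ℝ) 1)
    (hσ : σ ∈ Icc (-1 : ℝ) 1) (hz : ∀ i : Fin n, ‖z i - x i‖ < d i) (hs : ‖s - σ‖ < d n) :
    ‖complexCondDensity f n z s - (condDensity (realRestr f) n x σ : ℝ)‖ ≤ M / L / 4 := by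
  rw [← hf.complexCondDensity_toC hx hσ]
  exact (hf.norm_complexCondDensity_sub_le_of_bound hc hd hn (m := n + 1)
    (fun x hx y hy => hf.norm_apply_sub_le hd hn hx hy) hx hσ n.le_succ hz (fun _ => hs)
    (fun h => absurd h (by omega))).trans hc.le_quarter

/-- The last variable stays real, so only the first `n` move and the bound on the scale of d n is
available. -/
lemma Admissible.norm_complexCondDensity_sub_le_min (hc : SmallConst M L C)
    (hd : ∀ i, 0 < d i) (hf : Admissible M L C (fun i : Fin k => d i) f) {n : ℕ} (hn : n < k)
    {z : Fin n → ℂ} {x : Fin n → ℝ} {σ : ℝ} (hx : ∀ i, x i ∈ Icc (-1 : ℝ) 1)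
    (hσ : σ ∈ Icc (-1 : ℝ) 1) (hz : ∀ i : Fin n, ‖z i - x i‖ < d i) :
    ‖complexCondDensity f n z σ - complexCondDensity f n (toC x) σ‖ ≤
      4 * L / M ^ 2 * (C * min 1 (d n)) :=
  hf.norm_complexCondDensity_sub_le_of_bound hc hd hn (m := n)
    (fun _ hx _ hy => hf.norm_apply_sub_le_min hd hc.nonneg hn hx hy) hx hσ le_rfl hz
    (fun h => absurd h (lt_irrefl n)) (fun _ => rfl)

/-- The conditional density stays close to the positive reals. -/
lemma Admissible.exists_complexCondDensity_near (hc : SmallConst M L C)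
    (hd : ∀ i, 0 < d i) (hf : Admissible M L C (fun i : Fin k => d i) f) {n : ℕ} (hn : n < k)
    {z : Fin n → ℂ} {s : ℂ} (hz : z ∈ nbhdBox fun i : Fin n => d i)
    (hs : s ∈ thickening (d n) realSeg) :
    ∃ a ∈ Icc (M / L) (L / M), ‖complexCondDensity f n z s - (a : ℝ)‖ ≤ M / L / 4 := by
  obtain ⟨x, hx, hzx⟩ := exists_real_near_of_mem_nbhdBox hz
  obtain ⟨σ, hσ, hsσ⟩ := mem_thickening_realSeg.1 hs
  exact ⟨_, hf.condDensity_mem_Icc hc.M_pos hd hn hx hσ,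
    hf.norm_complexCondDensity_sub_le hc hd hn hx hσ hzx hsσ⟩

lemma Admissible.norm_complexCondDensity_le (hc : SmallConst M L C)
    (hd : ∀ i, 0 < d i) (hf : Admissible M L C (fun i : Fin k => d i) f) {n : ℕ} (hn : n < k)
    {z : Fin n → ℂ} {s : ℂ} (hz : z ∈ nbhdBox fun i : Fin n => d i)
    (hs : s ∈ thickening (d n) realSeg) : ‖complexCondDensity f n z s‖ ≤ 2 * (L / M) := by
  obtain ⟨a, ha, h⟩ := hf.exists_complexCondDensity_near hc hd hn hz hs
  have h1 := norm_sub_norm_le (complexCondDensity f n z s) (a : ℂ)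
  rw [Complex.norm_real, Real.norm_of_nonneg (hc.ratio_pos.le.trans ha.1)] at h1
  linarith [ha.2, hc.ratio_le, hc.ratio_pos]

lemma Admissible.le_norm_complexCondDensity (hc : SmallConst M L C)
    (hd : ∀ i, 0 < d i) (hf : Admissible M L C (fun i : Fin k => d i) f) {n : ℕ} (hn : n < k)
    {z : Fin n → ℂ} {s : ℂ} (hz : z ∈ nbhdBox fun i : Fin n => d i)
    (hs : s ∈ thickening (d n) realSeg) : M / L / 2 ≤ ‖complexCondDensity f n z s‖ := by
  obtain ⟨a, ha, h⟩ := hf.exists_complexCondDensity_near hc hd hn hz hs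
  have h1 := norm_sub_norm_le (a : ℂ) (complexCondDensity f n z s)
  rw [Complex.norm_real, Real.norm_of_nonneg (hc.ratio_pos.le.trans ha.1), norm_sub_rev] at h1
  linarith [ha.1, hc.ratio_pos]

lemma differentiable_init {n : ℕ} :
    Differentiable ℂ (fun z : Fin (n + 1) → ℂ => (Fin.init z : Fin n → ℂ)) :=
  differentiable_pi.2 fun i => by simp only [Fin.init]; fun_prop

lemma differentiableAt_snoc {E : Type*} [NormedAddCommGroup E] [NormedSpace ℂ E] {n : ℕ}
    {φ : E → Fin n → ℂ} {ψ : E → ℂ} {a : E} (hφ : DifferentiableAt ℂ φ a)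
    (hψ : DifferentiableAt ℂ ψ a) :
    DifferentiableAt ℂ (fun e => Fin.snoc (α := fun _ => ℂ) (φ e) (ψ e)) a := by
  refine differentiableAt_pi.2 fun i => ?_
  refine Fin.lastCases ?_ (fun i => ?_) i
  · simpa using hψ
  · simpa using differentiableAt_pi.1 hφ i

lemma Admissible.differentiableOn_complexCondDensity (hc : SmallConst M L C)
    (hd : ∀ i, 0 < d i) (hf : Admissible M L C (fun i : Fin k => d i) f) {n : ℕ} (hn : n < k) :
    DifferentiableOn ℂ (fun z : Fin (n + 1) → ℂ =>
      complexCondDensity f n (Fin.init z) (z (Fin.last n)))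
      (nbhdBox fun i : Fin (n + 1) => d i) := by
  simp only [complexCondDensity, Fin.snoc_init_self, div_eq_mul_inv]
  have h1 : DifferentiableOn ℂ
      (fun z : Fin (n + 1) → ℂ => complexMarginal f n (Fin.init z : Fin n → ℂ))
      (nbhdBox fun i : Fin (n + 1) => d i) :=
    (hf.differentiableOn_complexMarginal hd hn.le).comp differentiable_init.differentiableOn
      fun z hz => init_mem_nbhdBox hz
  refine (hf.differentiableOn_complexMarginal hd (Nat.succ_le_of_lt hn)).mul
    (h1.fun_inv fun z hz => ?_)
  exact norm_pos_iff.1 (lt_of_lt_of_le (half_pos hc.M_pos)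
    (hf.le_norm_complexMarginal hc hd hn.le (init_mem_nbhdBox hz)))

lemma Admissible.differentiableOn_complexCondDensity_right (hc : SmallConst M L C)
    (hd : ∀ i, 0 < d i) (hf : Admissible M L C (fun i : Fin k => d i) f) {n : ℕ} (hn : n < k)
    {z : Fin n → ℂ} (hz : z ∈ nbhdBox fun i : Fin n => d i) :
    DifferentiableOn ℂ (complexCondDensity f n z) (thickening (d n) realSeg) := by
  intro s hs
  have h1 := ((hf.differentiableOn_complexCondDensity hc hd hn) _
    (snoc_mem_nbhdBox hz hs)).differentiableAt ((isOpen_nbhdBox _).mem_nhds (snoc_mem_nbhdBox hz hs))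
  have h2 := h1.comp s (f := fun s => Fin.snoc (α := fun _ => ℂ) z s)
    (differentiableAt_snoc (differentiableAt_const z) differentiableAt_id)
  simp only [Function.comp_def, Fin.init_snoc, Fin.snoc_last] at h2
  exact h2.differentiableWithinAt

lemma Admissible.hasDerivAt_complexCondCDF (hc : SmallConst M L C)
    (hd : ∀ i, 0 < d i) (hf : Admissible M L C (fun i : Fin k => d i) f) {n : ℕ} (hn : n < k)
    {z : Fin n → ℂ} {s : ℂ} (hz : z ∈ nbhdBox fun i : Fin n => d i)
    (hs : s ∈ thickening (d n) realSeg) :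
    HasDerivAt (complexCondCDF f n z) (complexCondDensity f n z s / 2) s := by
  have h1 : (-1 : ℂ) ∈ thickening (d n) realSeg := by
    simpa using ofReal_mem_thickening (x := -1) (hd n) (by simp)
  exact hasDerivAt_mul_integral_segment (convex_thickening_realSeg (d n)) isOpen_thickening
    ((hf.differentiableOn_complexCondDensity_right hc hd hn hz).div_const 2) h1 hs

lemma Admissible.continuousOn_complexCondDensity_segment (hc : SmallConst M L C)
    (hd : ∀ i, 0 < d i) (hf : Admissible M L C (fun i : Fin k => d i) f) {n : ℕ} (hn : n < k)
    {z : Fin n → ℂ} {s : ℂ} (hz : z ∈ nbhdBox fun i : Fin n => d i)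
    (hs : s ∈ thickening (d n) realSeg) :
    ContinuousOn (fun t : ℝ => complexCondDensity f n z (-1 + t * (s - (-1))) / 2)
      (Icc 0 1) := by
  refine ((hf.differentiableOn_complexCondDensity_right hc hd hn hz).continuousOn.comp ?_
    fun t ht => segment_mem_thickening (hd n) hs ht).div_const 2
  fun_prop

/-- Joint holomorphy in all variables. Parametrising the segment by [0,1] makes the domain of
integration independent of the endpoint, so the parametric integral lemma applies. -/
lemma Admissible.differentiableOn_complexCondCDF (hc : SmallConst M L C)
    (hd : ∀ i, 0 < d i) (hf : Admissible M L C (fun i : Fin k => d i) f) {n : ℕ} (hn : n < k) :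
    DifferentiableOn ℂ (fun z : Fin (n + 1) → ℂ =>
      complexCondCDF f n (Fin.init z) (z (Fin.last n)))
      (nbhdBox fun i : Fin (n + 1) => d i) := by
  unfold complexCondCDF
  refine DifferentiableOn.mul (by fun_prop) ?_
  simp only [intervalIntegral.integral_of_le zero_le_one]
  refine differentiableOn_integral_of_bounded (isOpen_nbhdBox _) (B := L / M) ?_ ?_ ?_
  · intro z hz
    exact ((hf.continuousOn_complexCondDensity_segment hc hd hn (init_mem_nbhdBox hz)
      (hz (Fin.last n))).mono Ioc_subset_Icc_self).aestronglyMeasurable measurableSet_Ioc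
  · filter_upwards [ae_restrict_mem measurableSet_Ioc] with t ht
    have h1 : DifferentiableOn ℂ (fun z : Fin (n + 1) → ℂ =>
        Fin.snoc (α := fun _ => ℂ) (Fin.init z) (-1 + t * (z (Fin.last n) - (-1))))
        (nbhdBox fun i : Fin (n + 1) => d i) := fun z _ =>
      (differentiableAt_snoc differentiable_init.differentiableAt
        (by fun_prop)).differentiableWithinAt
    have h2 := ((hf.differentiableOn_complexCondDensity hc hd hn).comp h1 fun z hz =>
      snoc_mem_nbhdBox (init_mem_nbhdBox hz)
        (segment_mem_thickening (hd n) (hz (Fin.last n)) (Ioc_subset_Icc_self ht))).mul_const (2 : ℂ)⁻¹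
    simpa [Function.comp_def, div_eq_mul_inv] using h2
  · filter_upwards [ae_restrict_mem measurableSet_Ioc] with t ht z hz
    have := hf.norm_complexCondDensity_le hc hd hn (init_mem_nbhdBox hz)
      (segment_mem_thickening (hd n) (hz (Fin.last n)) (Ioc_subset_Icc_self ht))
    rw [norm_div]
    simp only [Complex.norm_ofNat]
    linarith

lemma segment_real_mem_Icc {σ t : ℝ} (hσ : σ ∈ Icc (-1 : ℝ) 1) (ht : t ∈ Icc (0 : ℝ) 1) :
    -1 + t * (σ - (-1)) ∈ Icc (-1 : ℝ) 1 := by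
  obtain ⟨h1, h2⟩ := hσ
  obtain ⟨h3, h4⟩ := ht
  constructor <;> nlinarith

lemma Admissible.complexCondCDF_toC (hf : Admissible M L C (fun i : Fin k => d i) f) {n : ℕ}
    {x : Fin n → ℝ} (hx : ∀ i, x i ∈ Icc (-1 : ℝ) 1) {σ : ℝ} (hσ : σ ∈ Icc (-1 : ℝ) 1) :
    complexCondCDF f n (toC x) σ = (condCDF (realRestr f) n x σ : ℂ) := by
  have h1 : condCDF (realRestr f) n x σ =
      (σ - (-1)) * ∫ t in (0 : ℝ)..1, condDensity (realRestr f) n x (-1 + (σ - (-1)) * t) / 2 := by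
    have := intervalIntegral.smul_integral_comp_add_mul (a := 0) (b := 1)
      (fun t => condDensity (realRestr f) n x t / 2) (σ - (-1)) (-1)
    rw [smul_eq_mul] at this
    rw [this, condCDF]
    congr 1 <;> ring
  rw [h1, complexCondCDF, Complex.ofReal_mul, ← intervalIntegral.integral_ofReal]
  push_cast
  congr 1
  refine intervalIntegral.integral_congr fun t ht => ?_
  rw [uIcc_of_le zero_le_one] at ht
  have h2 := hf.complexCondDensity_toC hx (segment_real_mem_Icc hσ ht)
  push_cast at h2
  rw [h2, mul_comm t]

/-- With a real endpoint the whole segment lies in [-1,1], so the sharper bound holds along it; its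
length, at most 2, cancels the factor 1/2. -/
lemma Admissible.norm_complexCondCDF_sub_le (hc : SmallConst M L C)
    (hd : ∀ i, 0 < d i) (hf : Admissible M L C (fun i : Fin k => d i) f) {n : ℕ} (hn : n < k)
    {z : Fin n → ℂ} {x : Fin n → ℝ} {σ : ℝ} (hx : ∀ i, x i ∈ Icc (-1 : ℝ) 1)
    (hσ : σ ∈ Icc (-1 : ℝ) 1) (hz : ∀ i : Fin n, ‖z i - x i‖ < d i) :
    ‖complexCondCDF f n z σ - complexCondCDF f n (toC x) σ‖ ≤
      4 * L / M ^ 2 * (C * min 1 (d n)) := by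
  have hzb : z ∈ nbhdBox fun i : Fin n => d i := mem_nbhdBox_of_near hx hz
  have hxb : toC x ∈ nbhdBox fun i : Fin n => d i := toC_mem_nbhdBox (fun i => hd i) hx
  have hσb := ofReal_mem_thickening (hd n) hσ
  have hi : ∀ w ∈ nbhdBox fun i : Fin n => d i, IntervalIntegrable
      (fun t : ℝ => complexCondDensity f n w (-1 + t * ((σ : ℂ) - (-1))) / 2) volume 0 1 :=
    fun w hw => ContinuousOn.intervalIntegrable (by
      rw [uIcc_of_le zero_le_one]
      exact hf.continuousOn_complexCondDensity_segment hc hd hn hw hσb)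
  rw [complexCondCDF, complexCondCDF, ← mul_sub,
    ← intervalIntegral.integral_sub (hi z hzb) (hi _ hxb), norm_mul]
  have h1 := intervalIntegral.norm_integral_le_of_norm_le_const (a := 0) (b := 1)
    (f := fun t : ℝ => complexCondDensity f n z (-1 + t * ((σ : ℂ) - (-1))) / 2 -
      complexCondDensity f n (toC x) (-1 + t * ((σ : ℂ) - (-1))) / 2)
    (C := 4 * L / M ^ 2 * (C * min 1 (d n)) / 2) (by
      intro t ht
      rw [uIoc_of_le zero_le_one] at ht
      have := hf.norm_complexCondDensity_sub_le_min hc hd hn hx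
        (segment_real_mem_Icc hσ (Ioc_subset_Icc_self ht)) hz
      push_cast at this
      rw [← sub_div, norm_div]
      simp only [Complex.norm_ofNat]
      linarith)
  have h2 : ‖(σ : ℂ) - (-1)‖ ≤ 2 := by
    have : (σ : ℂ) - (-1) = ((σ + 1 : ℝ) : ℂ) := by push_cast; ring
    rw [this, Complex.norm_real, Real.norm_of_nonneg (by linarith [hσ.1])]
    linarith [hσ.2]
  rw [sub_zero, abs_one, mul_one] at h1
  calc _ ≤ 2 * (4 * L / M ^ 2 * (C * min 1 (d n)) / 2) :=
        mul_le_mul h2 h1 (norm_nonneg _) zero_le_two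
    _ = _ := by ring

/-- The conditional distribution function is close to a linear map. -/
lemma Admissible.complexCondCDF_approx (hc : SmallConst M L C)
    (hd : ∀ i, 0 < d i) (hf : Admissible M L C (fun i : Fin k => d i) f) {n : ℕ} (hn : n < k)
    {z : Fin n → ℂ} (hz : z ∈ nbhdBox fun i : Fin n => d i) :
    ∀ u ∈ thickening (d n) realSeg, ∀ v ∈ thickening (d n) realSeg,
      ‖complexCondCDF f n z u - complexCondCDF f n z v - ((L / M / 2 : ℝ) : ℂ) * (u - v)‖ ≤
        Real.toNNReal (L / M / 2 - 3 / 8 * (M / L)) * ‖u - v‖ := by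
  have hκ : 0 ≤ L / M / 2 - 3 / 8 * (M / L) := by linarith [hc.ratio_le, hc.ratio_pos]
  refine approximatesLinearOn_of_deriv_near (convex_thickening_realSeg (d n))
    (fun w hw => hf.hasDerivAt_complexCondCDF hc hd hn hz hw) fun w hw => ?_
  obtain ⟨a, ha, h⟩ := hf.exists_complexCondDensity_near hc hd hn hz hw
  rw [Real.coe_toNNReal _ hκ]
  -- The derivative is compared with the top L/(2M) of its real range: the distance is at most (L/M
  -- - a)/2 + (M/L)/8 with a ≥ M/L. The gap between L/(2M) and this bound is 3/8 · M/L, the lower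
  -- Lipschitz constant below.
  have e : complexCondDensity f n z w / 2 - ((L / M / 2 : ℝ) : ℂ) =
      (complexCondDensity f n z w - (a : ℝ)) / 2 + (((a - L / M) / 2 : ℝ) : ℂ) := by
    push_cast; ring
  rw [e]
  refine (norm_add_le _ _).trans ?_
  rw [norm_div, Complex.norm_real, Real.norm_of_nonpos (by linarith [ha.2])]
  simp only [Complex.norm_ofNat]
  linarith [ha.1]

lemma Admissible.norm_complexCondCDF_sub_ge (hc : SmallConst M L C)
    (hd : ∀ i, 0 < d i) (hf : Admissible M L C (fun i : Fin k => d i) f) {n : ℕ} (hn : n < k)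
    {z : Fin n → ℂ} (hz : z ∈ nbhdBox fun i : Fin n => d i) {u v : ℂ}
    (hu : u ∈ thickening (d n) realSeg) (hv : v ∈ thickening (d n) realSeg) :
    3 / 8 * (M / L) * ‖u - v‖ ≤ ‖complexCondCDF f n z u - complexCondCDF f n z v‖ := by
  have hκ : 0 ≤ L / M / 2 - 3 / 8 * (M / L) := by linarith [hc.ratio_le, hc.ratio_pos]
  have h1 := norm_sub_ge_of_approx (by linarith [hc.ratio_le, hc.ratio_pos])
    (hf.complexCondCDF_approx hc hd hn hz u hu v hv)
  rw [Real.coe_toNNReal _ hκ] at h1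
  linarith

lemma Admissible.injOn_complexCondCDF (hc : SmallConst M L C)
    (hd : ∀ i, 0 < d i) (hf : Admissible M L C (fun i : Fin k => d i) f) {n : ℕ} (hn : n < k)
    {z : Fin n → ℂ} (hz : z ∈ nbhdBox fun i : Fin n => d i) :
    InjOn (complexCondCDF f n z) (thickening (d n) realSeg) := by
  intro u hu v hv huv
  have h1 := hf.norm_complexCondCDF_sub_ge hc hd hn hz hu hv
  rw [huv, sub_self, norm_zero] at h1
  have h2 := hc.ratio_pos
  have h3 : ‖u - v‖ ≤ 0 := by
    by_contra h
    have : 0 < 3 / 8 * (M / L) * ‖u - v‖ := by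
      have := not_le.1 h
      positivity
    linarith
  exact sub_eq_zero.1 (norm_le_zero_iff.1 h3)

lemma Admissible.norm_complexCondCDF_sub_le_right (hc : SmallConst M L C)
    (hd : ∀ i, 0 < d i) (hf : Admissible M L C (fun i : Fin k => d i) f) {n : ℕ} (hn : n < k)
    {z : Fin n → ℂ} (hz : z ∈ nbhdBox fun i : Fin n => d i) {u v : ℂ}
    (hu : u ∈ thickening (d n) realSeg) (hv : v ∈ thickening (d n) realSeg) :
    ‖complexCondCDF f n z u - complexCondCDF f n z v‖ ≤ L / M * ‖u - v‖ := by
  refine (convex_thickening_realSeg (d n)).norm_image_sub_le_of_norm_hasDerivWithin_le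
    (fun w hw => (hf.hasDerivAt_complexCondCDF hc hd hn hz hw).hasDerivWithinAt)
    (fun w hw => ?_) hv hu
  have := hf.norm_complexCondDensity_le hc hd hn hz hw
  rw [norm_div]
  simp only [Complex.norm_ofNat]
  linarith

/-- The conditional density is a probability density, also for complex values of the
conditioning variables. -/
lemma Admissible.integral_complexCondDensity (hc : SmallConst M L C)
    (hd : ∀ i, 0 < d i) (hf : Admissible M L C (fun i : Fin k => d i) f) {n : ℕ} (hn : n < k)
    {z : Fin n → ℂ} (hz : z ∈ nbhdBox fun i : Fin n => d i) :
    ∫ s, complexCondDensity f n z (s : ℝ) ∂unif = 1 := by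
  unfold complexCondDensity
  rw [integral_div, ← hf.complexMarginal_eq_integral hd hn.le hz]
  exact div_self (norm_pos_iff.1 (lt_of_lt_of_le (half_pos hc.M_pos)
    (hf.le_norm_complexMarginal hc hd hn.le hz)))

lemma Admissible.complexCondDensity_integrable (hc : SmallConst M L C)
    (hd : ∀ i, 0 < d i) (hf : Admissible M L C (fun i : Fin k => d i) f) {n : ℕ} (hn : n < k)
    {z : Fin n → ℂ} (hz : z ∈ nbhdBox fun i : Fin n => d i) :
    Integrable (fun s : ℝ => complexCondDensity f n z s) unif := by
  refine Integrable.smul_measure ?_ (by simp)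
  refine ContinuousOn.integrableOn_compact isCompact_Icc ?_
  exact (hf.differentiableOn_complexCondDensity_right hc hd hn hz).continuousOn.comp
    Complex.continuous_ofReal.continuousOn fun s hs => ofReal_mem_thickening (hd n) hs

/-- A conditional density with a large domain of holomorphy is close to `1` near the reals. -/
lemma Admissible.norm_complexCondDensity_sub_one_le (hc : SmallConst M L C)
    (hd : ∀ i, 0 < d i) (hf : Admissible M L C (fun i : Fin k => d i) f) {n : ℕ} (hn : n < k)
    {z : Fin n → ℂ} (hz : z ∈ nbhdBox fun i : Fin n => d i) {s : ℂ} {σ : ℝ}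
    (hσ : σ ∈ Icc (-1 : ℝ) 1) (hs : ‖s - σ‖ < d n / 2) (hs' : ‖s - σ‖ ≤ 1) :
    ‖complexCondDensity f n z s - 1‖ ≤ 24 * (L / M) / d n := by
  have hdn := hd n
  have hdiff := hf.differentiableOn_complexCondDensity_right hc hd hn hz
  have hsub : ∀ w ∈ thickening (d n / 2) realSeg,
      ball w (d n / 2) ⊆ thickening (d n) realSeg := by
    intro w hw v hv
    obtain ⟨y, hy, hwy⟩ := mem_thickening_realSeg.1 hw
    refine mem_thickening_realSeg.2 ⟨y, hy, ?_⟩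
    rw [mem_ball, dist_eq_norm] at hv
    have := norm_add_le (v - w) (w - y)
    rw [sub_add_sub_cancel] at this
    linarith
  have hmem : ∀ w ∈ thickening (d n / 2) realSeg, w ∈ thickening (d n) realSeg :=
    fun w hw => hsub w hw (mem_ball_self (by linarith))
  -- Cauchy's estimate on discs of radius d n / 2, on which the density varies by at most 4L/M.
  have hderiv : ∀ w ∈ thickening (d n / 2) realSeg,
      ‖deriv (complexCondDensity f n z) w‖ ≤ 8 * (L / M) / d n := by
    intro w hw
    refine (Complex.norm_deriv_le_div_of_mapsTo_ball (R₁ := d n / 2) (R₂ := 4 * (L / M))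
      (hdiff.mono (hsub w hw)) (fun v hv => ?_) (by linarith)).trans_eq (by ring)
    rw [mem_closedBall, dist_eq_norm]
    refine (norm_sub_le _ _).trans ?_
    have h1 := hf.norm_complexCondDensity_le hc hd hn hz (hsub w hw hv)
    have h2 := hf.norm_complexCondDensity_le hc hd hn hz (hmem w hw)
    linarith
  have hsb : s ∈ thickening (d n / 2) realSeg := mem_thickening_realSeg.2 ⟨σ, hσ, hs⟩
  have hlip : ∀ t ∈ Icc (-1 : ℝ) 1,
      ‖complexCondDensity f n z s - complexCondDensity f n z t‖ ≤ 24 * (L / M) / d n := by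
    intro t ht
    have h1 := (convex_thickening_realSeg (d n / 2)).norm_image_sub_le_of_norm_hasDerivWithin_le
      (f := complexCondDensity f n z) (f' := deriv (complexCondDensity f n z))
      (fun w hw => ((hdiff w (hmem w hw)).differentiableAt
        (isOpen_thickening.mem_nhds (hmem w hw))).hasDerivAt.hasDerivWithinAt)
      hderiv (ofReal_mem_thickening (half_pos hdn) ht) hsb
    -- Distance at most 1 from `s` to σ, and at most 2 within [-1,1]; whence 24 = 8 · 3.
    have h2 : ‖s - t‖ ≤ 3 := by
      have h3 := norm_add_le (s - σ) ((σ : ℂ) - t)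
      rw [sub_add_sub_cancel, ← Complex.ofReal_sub, Complex.norm_real, Real.norm_eq_abs] at h3
      have h4 : |σ - t| ≤ 2 := abs_le.2 ⟨by linarith [hσ.1, ht.2], by linarith [hσ.2, ht.1]⟩
      linarith
    have h5 : 0 ≤ 8 * (L / M) / d n := by
      have := hc.ratio_pos.trans_le hc.ratio_le
      positivity
    calc _ ≤ _ := h1
      _ ≤ 8 * (L / M) / d n * 3 := mul_le_mul_of_nonneg_left h2 h5
      _ = _ := by ring
  have hint := hf.complexCondDensity_integrable hc hd hn hz
  -- Since the density has mean 1, its deviation from 1 is an average of its oscillations.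
  have e : complexCondDensity f n z s - 1 =
      ∫ t, (complexCondDensity f n z s - complexCondDensity f n z (t : ℝ)) ∂unif := by
    rw [integral_sub (integrable_const _) hint, hf.integral_complexCondDensity hc hd hn hz]
    simp
  rw [e]
  refine (norm_integral_le_of_norm_le_const (ae_unif_mem_Icc.mono hlip)).trans_eq (by simp)

end Conditional

/-! ### Real distribution functions and the real transport -/

section RealCDF

variable {M L C : ℝ} {k : ℕ} {d : ℕ → ℝ} {f g : (ℕ → ℂ) → ℂ}

lemma Admissible.continuousOn_condDensity (hc : SmallConst M L C)
    (hd : ∀ i, 0 < d i) (hf : Admissible M L C (fun i : Fin k => d i) f) {n : ℕ} (hn : n < k)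
    {x : Fin n → ℝ} (hx : ∀ i, x i ∈ Icc (-1 : ℝ) 1) :
    ContinuousOn (condDensity (realRestr f) n x) (Icc (-1) 1) := by
  have h1 : ContinuousOn (fun s : ℝ => (complexCondDensity f n (toC x) s).re) (Icc (-1) 1) :=
    Complex.continuous_re.comp_continuousOn
      ((hf.differentiableOn_complexCondDensity_right hc hd hn
        (toC_mem_nbhdBox (fun i => hd i) hx)).continuousOn.comp
        Complex.continuous_ofReal.continuousOn fun s hs => ofReal_mem_thickening (hd n) hs)
  exact h1.congr fun s hs => by
    simp only [hf.complexCondDensity_toC hx hs, Complex.ofReal_re]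

lemma Admissible.continuousOn_condCDF (hc : SmallConst M L C)
    (hd : ∀ i, 0 < d i) (hf : Admissible M L C (fun i : Fin k => d i) f) {n : ℕ} (hn : n < k)
    {x : Fin n → ℝ} (hx : ∀ i, x i ∈ Icc (-1 : ℝ) 1) :
    ContinuousOn (condCDF (realRestr f) n x) (Icc (-1) 1) := by
  have h1 : ContinuousOn (fun s : ℝ => (complexCondCDF f n (toC x) s).re) (Icc (-1) 1) := by
    refine Complex.continuous_re.comp_continuousOn fun s hs => ?_
    exact ((hf.hasDerivAt_complexCondCDF hc hd hn (toC_mem_nbhdBox (fun i => hd i) hx)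
      (ofReal_mem_thickening (hd n) hs)).continuousAt.comp
        Complex.continuous_ofReal.continuousAt).continuousWithinAt
  exact h1.congr fun s hs => by
    simp only [hf.complexCondCDF_toC hx hs, Complex.ofReal_re]

lemma condCDF_neg_one (f : (ℕ → ℝ) → ℝ) (n : ℕ) (x : Fin n → ℝ) : condCDF f n x (-1) = 0 := by
  simp [condCDF]

lemma Admissible.condCDF_one (hc : SmallConst M L C)
    (hd : ∀ i, 0 < d i) (hf : Admissible M L C (fun i : Fin k => d i) f) {n : ℕ} (hn : n < k)
    {x : Fin n → ℝ} (hx : ∀ i, x i ∈ Icc (-1 : ℝ) 1) : condCDF (realRestr f) n x 1 = 1 := by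
  have h1 := hf.integral_complexCondDensity hc hd hn (toC_mem_nbhdBox (fun i => hd i) hx)
  have h2 : ∫ s, complexCondDensity f n (toC x) (s : ℝ) ∂unif =
      ∫ s, ((condDensity (realRestr f) n x s : ℝ) : ℂ) ∂unif :=
    integral_congr_ae (ae_unif_mem_Icc.mono fun s hs => hf.complexCondDensity_toC hx hs)
  rw [h2, integral_complex_ofReal, integral_unif] at h1
  have h3 : (2 : ℝ)⁻¹ • ∫ s in (-1 : ℝ)..1, condDensity (realRestr f) n x s = 1 := by
    exact_mod_cast h1
  rw [condCDF, intervalIntegral.integral_div, div_eq_inv_mul]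
  exact h3

lemma Admissible.condCDF_mem_Icc (hc : SmallConst M L C)
    (hd : ∀ i, 0 < d i) (hf : Admissible M L C (fun i : Fin k => d i) f) {n : ℕ} (hn : n < k)
    {x : Fin n → ℝ} (hx : ∀ i, x i ∈ Icc (-1 : ℝ) 1) {s : ℝ} (hs : s ∈ Icc (-1 : ℝ) 1) :
    condCDF (realRestr f) n x s ∈ Icc (0 : ℝ) 1 := by
  have hpos : ∀ t ∈ Icc (-1 : ℝ) 1, 0 ≤ condDensity (realRestr f) n x t / 2 := fun t ht =>
    div_nonneg (hc.ratio_pos.le.trans (hf.condDensity_mem_Icc hc.M_pos hd hn hx ht).1) zero_le_two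
  constructor
  · exact intervalIntegral.integral_nonneg hs.1 fun t ht => hpos t ⟨ht.1, ht.2.trans hs.2⟩
  · rw [← hf.condCDF_one hc hd hn hx]
    refine intervalIntegral.integral_mono_interval le_rfl hs.1 hs.2 ?_ ?_
    · filter_upwards [ae_restrict_mem measurableSet_Ioc] with t ht
      exact hpos t (Ioc_subset_Icc_self ht)
    · refine ContinuousOn.intervalIntegrable ?_
      rw [uIcc_of_le (by norm_num)]
      exact (hf.continuousOn_condDensity hc hd hn hx).div_const 2

/-- `Function.invFunOn` is a genuine preimage only at attained values. The intermediate value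
theorem between 0 at -1 and 1 at 1 provides them. -/
lemma Admissible.exists_condCDF_eq (hc : SmallConst M L C)
    (hd : ∀ i, 0 < d i) (hg : Admissible M L C (fun i : Fin k => d i) g) {n : ℕ} (hn : n < k)
    {y : Fin n → ℝ} (hy : ∀ i, y i ∈ Icc (-1 : ℝ) 1) {u : ℝ} (hu : u ∈ Icc (0 : ℝ) 1) :
    ∃ s ∈ Icc (-1 : ℝ) 1, condCDF (realRestr g) n y s = u := by
  have h1 := intermediate_value_Icc (by norm_num) (hg.continuousOn_condCDF hc hd hn hy)
  rw [condCDF_neg_one, hg.condCDF_one hc hd hn hy] at h1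
  exact h1 hu

lemma transport_succ_last (f g : (ℕ → ℝ) → ℝ) (n : ℕ) (x : Fin (n + 1) → ℝ) :
    transport f g (n + 1) x (Fin.last n) =
      Function.invFunOn (condCDF g n (transport f g n (Fin.init x))) (Icc (-1) 1)
          (condCDF f n (Fin.init x) (x (Fin.last n))) := by
  simp [transport]

lemma init_transport_succ (f g : (ℕ → ℝ) → ℝ) (n : ℕ) (x : Fin (n + 1) → ℝ) :
    Fin.init (transport f g (n + 1) x) = transport f g n (Fin.init x) := by
  simp [transport]

lemma transport_mem_Icc (hc : SmallConst M L C) (hd : ∀ i, 0 < d i)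
    (hf : Admissible M L C (fun i : Fin k => d i) f)
    (hg : Admissible M L C (fun i : Fin k => d i) g) {n : ℕ} (hn : n ≤ k)
    {x : Fin n → ℝ} (hx : ∀ i, x i ∈ Icc (-1 : ℝ) 1) (i : Fin n) :
    transport (realRestr f) (realRestr g) n x i ∈ Icc (-1 : ℝ) 1 := by
  induction n with
  | zero => exact i.elim0
  | succ n ih =>
    have hx' : ∀ i, (Fin.init x : Fin n → ℝ) i ∈ Icc (-1 : ℝ) 1 := fun i => hx i.castSucc
    refine Fin.lastCases ?_ (fun i => ?_) i
    · rw [transport_succ_last]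
      exact Function.invFunOn_mem (hg.exists_condCDF_eq hc hd hn (ih (by omega) hx')
        (hf.condCDF_mem_Icc hc hd hn hx' (hx (Fin.last n))))
    · have := ih (by omega) hx' i
      rw [← init_transport_succ] at this
      exact this

lemma condCDF_transport (hc : SmallConst M L C) (hd : ∀ i, 0 < d i)
    (hf : Admissible M L C (fun i : Fin k => d i) f)
    (hg : Admissible M L C (fun i : Fin k => d i) g) {n : ℕ} (hn : n < k)
    {x : Fin (n + 1) → ℝ} (hx : ∀ i, x i ∈ Icc (-1 : ℝ) 1) :
    condCDF (realRestr g) n (transport (realRestr f) (realRestr g) n (Fin.init x))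
        (transport (realRestr f) (realRestr g) (n + 1) x (Fin.last n)) =
      condCDF (realRestr f) n (Fin.init x) (x (Fin.last n)) := by
  have hx' : ∀ i, (Fin.init x : Fin n → ℝ) i ∈ Icc (-1 : ℝ) 1 := fun i => hx i.castSucc
  rw [transport_succ_last]
  exact Function.invFunOn_eq (hg.exists_condCDF_eq hc hd hn
    (transport_mem_Icc hc hd hf hg hn.le hx')
    (hf.condCDF_mem_Icc hc hd hn hx' (hx (Fin.last n))))

end RealCDF

/-! ### The complex transport -/

/-- The Knothe–Rosenblatt transport for complex arguments: the conditional distribution function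
of `g` is inverted on the `d n`-neighbourhood of `[-1,1]`. -/
def complexTransport (d : ℕ → ℝ) (f g : (ℕ → ℂ) → ℂ) : (n : ℕ) → (Fin n → ℂ) → (Fin n → ℂ)
  | 0, z => z
  | n + 1, z =>
      Fin.snoc (α := fun _ => ℂ) (complexTransport d f g n (Fin.init z))
        (Function.invFunOn (complexCondCDF g n (complexTransport d f g n (Fin.init z)))
          (thickening (d n) realSeg) (complexCondCDF f n (Fin.init z) (z (Fin.last n))))

lemma complexTransport_succ_last (d : ℕ → ℝ) (f g : (ℕ → ℂ) → ℂ) (n : ℕ) (z : Fin (n + 1) → ℂ) :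
    complexTransport d f g (n + 1) z (Fin.last n) =
      Function.invFunOn (complexCondCDF g n (complexTransport d f g n (Fin.init z)))
          (thickening (d n) realSeg) (complexCondCDF f n (Fin.init z) (z (Fin.last n))) := by
  simp [complexTransport]

lemma init_complexTransport_succ (d : ℕ → ℝ) (f g : (ℕ → ℂ) → ℂ) (n : ℕ) (z : Fin (n + 1) → ℂ) :
    Fin.init (complexTransport d f g (n + 1) z) = complexTransport d f g n (Fin.init z) := by
  simp [complexTransport]

section Transport

variable {M L C c : ℝ} {k : ℕ} {d : ℕ → ℝ} {f g : (ℕ → ℂ) → ℂ}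

/-- A real solution of the equation defining the transport almost solves it at nearby complex
points. -/
lemma norm_complexCondCDF_sub_complexCondCDF_le (hc : SmallConst M L C) (hd : ∀ i, 0 < d i)
    (hf : Admissible M L C (fun i : Fin k => d i) f)
    (hg : Admissible M L C (fun i : Fin k => d i) g) {n : ℕ} (hn : n < k)
    {z w : Fin n → ℂ} {x y : Fin n → ℝ} {s : ℂ} {σ τ : ℝ}
    (hx : ∀ i, x i ∈ Icc (-1 : ℝ) 1) (hy : ∀ i, y i ∈ Icc (-1 : ℝ) 1)
    (hσ : σ ∈ Icc (-1 : ℝ) 1) (hτ : τ ∈ Icc (-1 : ℝ) 1)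
    (hz : ∀ i, ‖z i - x i‖ < d i) (hw : ∀ i, ‖w i - y i‖ < d i) (hs : ‖s - σ‖ < d n)
    (heq : condCDF (realRestr g) n y τ = condCDF (realRestr f) n x σ) :
    ‖complexCondCDF f n z s - complexCondCDF g n w τ‖ ≤
      2 * (4 * L / M ^ 2 * (C * min 1 (d n))) + L / M * ‖s - σ‖ := by
  have h1 := hf.norm_complexCondCDF_sub_le hc hd hn hx hσ hz
  have h2 := hg.norm_complexCondCDF_sub_le hc hd hn hy hτ hw
  have h3 := hf.norm_complexCondCDF_sub_le_right hc hd hn (mem_nbhdBox_of_near hx hz)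
    (mem_thickening_realSeg.2 ⟨σ, hσ, hs⟩) (ofReal_mem_thickening (hd n) hσ)
  have e : complexCondCDF f n z s - complexCondCDF g n w τ =
      (complexCondCDF f n z s - complexCondCDF f n z σ) +
      (complexCondCDF f n z σ - complexCondCDF f n (toC x) σ) -
      (complexCondCDF g n w τ - complexCondCDF g n (toC y) τ) := by
    rw [hf.complexCondCDF_toC hx hσ, hg.complexCondCDF_toC hy hτ, heq]
    ring
  rw [e]
  have h4 := norm_sub_le ((complexCondCDF f n z s - complexCondCDF f n z σ) +
      (complexCondCDF f n z σ - complexCondCDF f n (toC x) σ))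
      (complexCondCDF g n w τ - complexCondCDF g n (toC y) τ)
  have h5 := norm_add_le (complexCondCDF f n z s - complexCondCDF f n z σ)
      (complexCondCDF f n z σ - complexCondCDF f n (toC x) σ)
  linarith

/-- Solvability of the equation defining the transport, near a real solution. -/
lemma exists_complexCondCDF_eq (hc : SmallConst M L C) (hd : ∀ i, 0 < d i)
    (hg : Admissible M L C (fun i : Fin k => d i) g) {n : ℕ} (hn : n < k)
    {w : Fin n → ℂ} (hw : w ∈ nbhdBox fun i : Fin n => d i) {τ : ℝ} (hτ : τ ∈ Icc (-1 : ℝ) 1)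
    {u : ℂ} (hu : ‖u - complexCondCDF g n w τ‖ ≤ 3 / 8 * (M / L) * (d n / 4)) :
    ∃ v ∈ thickening (d n) realSeg, complexCondCDF g n w v = u := by
  have hκ : 0 ≤ L / M / 2 - 3 / 8 * (M / L) := by linarith [hc.ratio_le, hc.ratio_pos]
  have hdn := hd n
  have hsub : closedBall (τ : ℂ) (d n / 4) ⊆ thickening (d n) realSeg := fun v hv => by
    rw [mem_closedBall, dist_eq_norm] at hv
    exact mem_thickening_realSeg.2 ⟨τ, hτ, by linarith⟩
  obtain ⟨v, hv, hvu⟩ := exists_mem_closedBall_eq_of_approx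
    (by linarith [hc.ratio_le, hc.ratio_pos]) (hg.complexCondCDF_approx hc hd hn hw)
    (by linarith) hsub (u := u) (by
      rw [Real.coe_toNNReal _ hκ, sub_sub_cancel]
      exact hu)
  exact ⟨v, hsub hv, hvu⟩

/-- The defining properties of the last component of the complex transport, given control of the
previous components. -/
lemma complexTransport_succ_spec (hc : SmallConst M L C) (hd : ∀ i, 0 < d i) (hc1 : c ≤ 1)
    (hcr : L / M * c ≤ M / L / 32)
    (hf : Admissible M L C (fun i : Fin k => d i) f)
    (hg : Admissible M L C (fun i : Fin k => d i) g) {n : ℕ} (hn : n < k)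
    {z : Fin (n + 1) → ℂ} {x : Fin (n + 1) → ℝ} (hx : ∀ i, x i ∈ Icc (-1 : ℝ) 1)
    (hz : ∀ i, ‖z i - x i‖ < c * d i)
    (hw : ∀ i, ‖complexTransport d f g n (Fin.init z) i -
      transport (realRestr f) (realRestr g) n (Fin.init x) i‖ ≤ d i / 4) :
    complexTransport d f g (n + 1) z (Fin.last n) ∈ thickening (d n) realSeg ∧
    complexCondCDF g n (complexTransport d f g n (Fin.init z))
      (complexTransport d f g (n + 1) z (Fin.last n)) =
        complexCondCDF f n (Fin.init z) (z (Fin.last n)) ∧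
    3 / 8 * (M / L) * ‖complexTransport d f g (n + 1) z (Fin.last n) -
      transport (realRestr f) (realRestr g) (n + 1) x (Fin.last n)‖ ≤
      2 * (4 * L / M ^ 2 * (C * min 1 (d n))) + L / M * ‖z (Fin.last n) - x (Fin.last n)‖ := by
  have hx' : ∀ i, (Fin.init x : Fin n → ℝ) i ∈ Icc (-1 : ℝ) 1 := fun i => hx i.castSucc
  have hy' := transport_mem_Icc hc hd hf hg hn.le hx'
  have hτ := transport_mem_Icc hc hd hf hg (Nat.succ_le_of_lt hn) hx (Fin.last n)
  have hlt : ∀ i : ℕ, c * d i ≤ d i := fun i => by nlinarith [hd i]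
  have hz' : ∀ i : Fin n, ‖(Fin.init z : Fin n → ℂ) i - (Fin.init x : Fin n → ℝ) i‖ < d i :=
    fun i => (hz i.castSucc).trans_le (hlt i)
  have hw' : ∀ i, ‖complexTransport d f g n (Fin.init z) i -
      transport (realRestr f) (realRestr g) n (Fin.init x) i‖ < d i :=
    fun i => (hw i).trans_lt (by linarith [hd i])
  have hs := hz (Fin.last n)
  rw [Fin.val_last] at hs
  have hbox := mem_nbhdBox_of_near hy' hw'
  have hdef := norm_complexCondCDF_sub_complexCondCDF_le hc hd hf hg hn hx' hy'
    (hx (Fin.last n)) hτ hz' hw' (hs.trans_le (hlt n)) (condCDF_transport hc hd hf hg hn hx)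
  have hΛ := hc.ratio_pos.trans_le hc.ratio_le
  -- In units of M/L · d n, the defect is at most 2/64 + 1/32 = 1/16, below the allowed 3/8 · 1/4 =
  -- 3/32.
  have hex := exists_complexCondCDF_eq hc hd hg hn hbox hτ (hdef.trans (by
    have h1 := hc.mul_min_le (min_le_right 1 (d n)) (hd n).le
    have h2 : L / M * ‖z (Fin.last n) - x (Fin.last n)‖ ≤ L / M * (c * d n) :=
      mul_le_mul_of_nonneg_left hs.le hΛ.le
    have h3 : L / M * (c * d n) ≤ M / L / 32 * d n := by
      rw [← mul_assoc]
      exact mul_le_mul_of_nonneg_right hcr (hd n).le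
    have h4 := mul_pos hc.ratio_pos (hd n)
    linarith))
  have hmem : complexTransport d f g (n + 1) z (Fin.last n) ∈ thickening (d n) realSeg := by
    rw [complexTransport_succ_last]
    exact Function.invFunOn_mem hex
  have heq : complexCondCDF g n (complexTransport d f g n (Fin.init z))
      (complexTransport d f g (n + 1) z (Fin.last n)) =
        complexCondCDF f n (Fin.init z) (z (Fin.last n)) := by
    rw [complexTransport_succ_last]
    exact Function.invFunOn_eq hex
  refine ⟨hmem, heq, ?_⟩
  refine (hg.norm_complexCondCDF_sub_ge hc hd hn hbox hmem
    (ofReal_mem_thickening (hd n) hτ)).trans ?_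
  rw [heq]
  exact hdef

/-- The complex transport stays close to the values of the real transport at nearby points. -/
lemma norm_complexTransport_sub_transport_le (hc : SmallConst M L C) (hd : ∀ i, 0 < d i)
    (hc1 : c ≤ 1) (hcr : L / M * c ≤ M / L / 32)
    (hf : Admissible M L C (fun i : Fin k => d i) f)
    (hg : Admissible M L C (fun i : Fin k => d i) g) {n : ℕ} (hn : n ≤ k)
    {z : Fin n → ℂ} {x : Fin n → ℝ} (hx : ∀ i, x i ∈ Icc (-1 : ℝ) 1)
    (hz : ∀ i, ‖z i - x i‖ < c * d i) (i : Fin n) :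
    ‖complexTransport d f g n z i - transport (realRestr f) (realRestr g) n x i‖ ≤ d i / 4 := by
  induction n with
  | zero => exact i.elim0
  | succ n ih =>
    have hw := ih (by omega) (z := Fin.init z) (x := Fin.init x) (fun i => hx i.castSucc)
      (fun i => hz i.castSucc)
    refine Fin.lastCases ?_ (fun i => ?_) i
    -- The induction hypothesis serves only to keep the earlier components in their discs; their
    -- actual errors do not enter, so d i / 4 reproduces itself at every step.
    · have h := (complexTransport_succ_spec hc hd hc1 hcr hf hg hn hx hz hw).2.2
      have hs := hz (Fin.last n)
      have hΛ := hc.ratio_pos.trans_le hc.ratio_le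
      rw [Fin.val_last] at hs ⊢
      have h1 := hc.mul_min_le (min_le_right 1 (d n)) (hd n).le
      have h2 : L / M * ‖z (Fin.last n) - x (Fin.last n)‖ ≤ L / M * (c * d n) :=
        mul_le_mul_of_nonneg_left hs.le hΛ.le
      have h3 : L / M * (c * d n) ≤ M / L / 32 * d n := by
        rw [← mul_assoc]
        exact mul_le_mul_of_nonneg_right hcr (hd n).le
      have h4 := mul_pos hc.ratio_pos (hd n)
      refine le_of_mul_le_mul_left (a := 3 / 8 * (M / L)) ?_ (by linarith [hc.ratio_pos])
      linarith
    · have := hw i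
      rw [← init_transport_succ, ← init_complexTransport_succ] at this
      exact this

/-- At real points the real transport also solves the complex equation in the same neighbourhood,
where the distribution function is injective. -/
lemma complexTransport_toC (hc : SmallConst M L C) (hd : ∀ i, 0 < d i)
    (hf : Admissible M L C (fun i : Fin k => d i) f)
    (hg : Admissible M L C (fun i : Fin k => d i) g) {n : ℕ} (hn : n ≤ k)
    {x : Fin n → ℝ} (hx : ∀ i, x i ∈ Icc (-1 : ℝ) 1) :
    complexTransport d f g n (toC x) = toC (transport (realRestr f) (realRestr g) n x) := by
  induction n with
  | zero => funext i; exact i.elim0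
  | succ n ih =>
    have hx' : ∀ i, (Fin.init x : Fin n → ℝ) i ∈ Icc (-1 : ℝ) 1 := fun i => hx i.castSucc
    have hinit : complexTransport d f g n (Fin.init (toC x)) =
        toC (transport (realRestr f) (realRestr g) n (Fin.init x)) := ih (by omega) hx'
    have hy' := transport_mem_Icc hc hd hf hg (Nat.le_of_succ_le hn) hx'
    have hτ := transport_mem_Icc hc hd hf hg hn hx (Fin.last n)
    have hτb := ofReal_mem_thickening (hd n) hτ
    funext i
    refine Fin.lastCases ?_ (fun i => ?_) i
    · have hsol : complexCondCDF g n (complexTransport d f g n (Fin.init (toC x)))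
          ((transport (realRestr f) (realRestr g) (n + 1) x (Fin.last n) : ℝ) : ℂ) =
          complexCondCDF f n (Fin.init (toC x)) (toC x (Fin.last n)) := by
        rw [hinit, hg.complexCondCDF_toC hy' hτ, condCDF_transport hc hd hf hg hn hx]
        exact (hf.complexCondCDF_toC hx' (hx (Fin.last n))).symm
      rw [complexTransport_succ_last]
      refine (hg.injOn_complexCondCDF hc hd hn (z := complexTransport d f g n (Fin.init (toC x)))
        ?_) (Function.invFunOn_mem ⟨_, hτb, hsol⟩) hτb ?_
      · rw [hinit]
        exact toC_mem_nbhdBox (fun i => hd i) hy'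
      · rw [Function.invFunOn_eq ⟨_, hτb, hsol⟩]
        exact hsol.symm
    · have h1 : complexTransport d f g (n + 1) (toC x) i.castSucc =
          Fin.init (complexTransport d f g (n + 1) (toC x)) i := rfl
      have h2 : toC (transport (realRestr f) (realRestr g) (n + 1) x) i.castSucc =
          toC (Fin.init (transport (realRestr f) (realRestr g) (n + 1) x)) i := rfl
      rw [h1, h2, init_complexTransport_succ, init_transport_succ, hinit]

lemma complexTransport_mem_nbhdBox (hc : SmallConst M L C) (hd : ∀ i, 0 < d i)
    (hc1 : c ≤ 1) (hcr : L / M * c ≤ M / L / 32)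
    (hf : Admissible M L C (fun i : Fin k => d i) f)
    (hg : Admissible M L C (fun i : Fin k => d i) g) {n : ℕ} (hn : n ≤ k)
    {z : Fin n → ℂ} (hz : z ∈ nbhdBox fun i : Fin n => c * d i) :
    complexTransport d f g n z ∈ nbhdBox fun i : Fin n => d i := by
  obtain ⟨x, hx, hzx⟩ := exists_real_near_of_mem_nbhdBox hz
  exact mem_nbhdBox_of_near (transport_mem_Icc hc hd hf hg hn hx) fun i =>
    (norm_complexTransport_sub_transport_le hc hd hc1 hcr hf hg hn hx hzx i).trans_lt
      (by linarith [hd i])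

lemma complexCondCDF_complexTransport (hc : SmallConst M L C) (hd : ∀ i, 0 < d i)
    (hc1 : c ≤ 1) (hcr : L / M * c ≤ M / L / 32)
    (hf : Admissible M L C (fun i : Fin k => d i) f)
    (hg : Admissible M L C (fun i : Fin k => d i) g) {n : ℕ} (hn : n < k)
    {z : Fin (n + 1) → ℂ} (hz : z ∈ nbhdBox fun i : Fin (n + 1) => c * d i) :
    complexCondCDF g n (complexTransport d f g n (Fin.init z))
      (complexTransport d f g (n + 1) z (Fin.last n)) =
        complexCondCDF f n (Fin.init z) (z (Fin.last n)) := by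
  obtain ⟨x, hx, hzx⟩ := exists_real_near_of_mem_nbhdBox hz
  exact (complexTransport_succ_spec hc hd hc1 hcr hf hg hn hx hzx
    (norm_complexTransport_sub_transport_le hc hd hc1 hcr hf hg hn.le
      (fun i => hx i.castSucc) (fun i => hzx i.castSucc))).2.1

/-- The complex transport is holomorphic. -/
lemma differentiableOn_complexTransport (hc : SmallConst M L C) (hd : ∀ i, 0 < d i)
    (hc1 : c ≤ 1) (hcr : L / M * c ≤ M / L / 32)
    (hf : Admissible M L C (fun i : Fin k => d i) f)
    (hg : Admissible M L C (fun i : Fin k => d i) g) {n : ℕ} (hn : n ≤ k) :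
    DifferentiableOn ℂ (complexTransport d f g n) (nbhdBox fun i : Fin n => c * d i) := by
  induction n with
  | zero => exact fun z _ => (differentiable_of_subsingleton z).differentiableWithinAt
  | succ n ih =>
    have ih := ih (by omega)
    intro z₀ hz₀
    have hnk : n < k := hn
    have hmem : ∀ z ∈ nbhdBox fun i : Fin (n + 1) => c * d i,
        complexTransport d f g n (Fin.init z) ∈ nbhdBox fun i : Fin n => d i := fun z hz =>
      complexTransport_mem_nbhdBox hc hd hc1 hcr hf hg hnk.le
        (init_mem_nbhdBox (d := fun i => c * d i) hz)
    have hlast : ∀ z ∈ nbhdBox fun i : Fin (n + 1) => c * d i,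
        complexTransport d f g (n + 1) z (Fin.last n) ∈ thickening (d n) realSeg := fun z hz =>
      complexTransport_mem_nbhdBox hc hd hc1 hcr hf hg hn hz (Fin.last n)
    have hsmall : ∀ z ∈ nbhdBox fun i : Fin (n + 1) => c * d i,
        z ∈ nbhdBox fun i : Fin (n + 1) => d i := fun z hz i =>
      thickening_mono (by nlinarith [hd i]) _ (hz i)
    have hnhds := (isOpen_nbhdBox _).mem_nhds hz₀
    have hinit : DifferentiableAt ℂ (fun z : Fin (n + 1) → ℂ =>
        complexTransport d f g n (Fin.init z)) z₀ := by
      have hz' := init_mem_nbhdBox (d := fun i => c * d i) hz₀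
      exact ((ih _ hz').differentiableAt ((isOpen_nbhdBox _).mem_nhds hz')).comp z₀
        (f := fun z : Fin (n + 1) → ℂ => (Fin.init z : Fin n → ℂ))
        differentiable_init.differentiableAt
    have hlastdiff : DifferentiableAt ℂ
        (fun z => complexTransport d f g (n + 1) z (Fin.last n)) z₀ := by
      -- The last component is a zero of `H` in its second variable. The bi-Lipschitz bound, uniform
      -- in z, makes the values chosen by `Function.invFunOn` at different points depend regularly
      -- on z.
      let H : (Fin (n + 1) → ℂ) × ℂ → ℂ := fun p =>
        complexCondCDF g n (complexTransport d f g n (Fin.init p.1)) p.2 -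
          complexCondCDF f n (Fin.init p.1) (p.1 (Fin.last n))
      have hHdiff : DifferentiableAt ℂ H
          (z₀, complexTransport d f g (n + 1) z₀ (Fin.last n)) := by
        have hb := snoc_mem_nbhdBox (hmem z₀ hz₀) (hlast z₀ hz₀)
        have h1 := ((hg.differentiableOn_complexCondCDF hc hd hnk) _ hb).differentiableAt
          ((isOpen_nbhdBox _).mem_nhds hb)
        have h2 : DifferentiableAt ℂ (fun p : (Fin (n + 1) → ℂ) × ℂ =>
            Fin.snoc (α := fun _ => ℂ) (complexTransport d f g n (Fin.init p.1)) p.2)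
            (z₀, complexTransport d f g (n + 1) z₀ (Fin.last n)) :=
          differentiableAt_snoc
            (DifferentiableAt.comp (g := fun z : Fin (n + 1) → ℂ =>
              complexTransport d f g n (Fin.init z)) _ hinit differentiableAt_fst)
            differentiableAt_snd
        have h3 := DifferentiableAt.comp
          (z₀, complexTransport d f g (n + 1) z₀ (Fin.last n)) h1 h2
        simp only [Function.comp_def, Fin.init_snoc, Fin.snoc_last] at h3
        have h4 := ((hf.differentiableOn_complexCondCDF hc hd hnk) _
          (hsmall z₀ hz₀)).differentiableAt ((isOpen_nbhdBox _).mem_nhds (hsmall z₀ hz₀))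
        exact h3.sub (DifferentiableAt.comp
          (g := fun z : Fin (n + 1) → ℂ => complexCondCDF f n (Fin.init z) (z (Fin.last n)))
          (z₀, complexTransport d f g (n + 1) z₀ (Fin.last n)) h4 differentiableAt_fst)
      refine differentiableAt_of_implicit (c := 3 / 8 * (M / L)) (by linarith [hc.ratio_pos])
        hHdiff ?_ ?_
        (d := complexCondDensity g n (complexTransport d f g n (Fin.init z₀))
          (complexTransport d f g (n + 1) z₀ (Fin.last n)) / 2) ?_ ?_
      · filter_upwards [hnhds] with z hz
        exact sub_eq_zero.2 (complexCondCDF_complexTransport hc hd hc1 hcr hf hg hnk hz)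
      · filter_upwards [hnhds] with z hz
        simp only [H, sub_sub_sub_cancel_right]
        exact hg.norm_complexCondCDF_sub_ge hc hd hnk (hmem z hz) (hlast z hz) (hlast z₀ hz₀)
      · refine div_ne_zero (norm_pos_iff.1 (lt_of_lt_of_le ?_
          (hg.le_norm_complexCondDensity hc hd hnk (hmem z₀ hz₀) (hlast z₀ hz₀)))) two_ne_zero
        linarith [hc.ratio_pos]
      · exact (hg.hasDerivAt_complexCondCDF hc hd hnk (hmem z₀ hz₀) (hlast z₀ hz₀)).sub_const
          (complexCondCDF f n (Fin.init z₀) (z₀ (Fin.last n)))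
    have e : complexTransport d f g (n + 1) = fun z => Fin.snoc (α := fun _ => ℂ)
        (complexTransport d f g n (Fin.init z))
        (complexTransport d f g (n + 1) z (Fin.last n)) := by
      funext z
      rw [← init_complexTransport_succ, Fin.snoc_init_self]
    rw [e]
    exact (differentiableAt_snoc hinit hlastdiff).differentiableWithinAt

end Transport

/-! ### The derivative of the transport -/

/-- Both numbers lie in a narrow sector around the positive axis. In Re(p/q) = (Re p Re q + Im p Im
q)/|q|² the numerator is at least (9/16 - 1/16) m², and |q|² ≤ 4Λ². -/
lemma le_re_div_of_near {m Λ a b : ℝ} {p q : ℂ} (hm : 0 < m) (ha : a ∈ Icc m Λ)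
    (hb : b ∈ Icc m Λ) (hp : ‖p - a‖ ≤ m / 4) (hq : ‖q - b‖ ≤ m / 4) :
    m ^ 2 / (8 * Λ ^ 2) ≤ (p / q).re := by
  have p1 := (Complex.abs_re_le_norm (p - a)).trans hp
  have p2 := (Complex.abs_im_le_norm (p - a)).trans hp
  have q1 := (Complex.abs_re_le_norm (q - b)).trans hq
  have q2 := (Complex.abs_im_le_norm (q - b)).trans hq
  simp only [Complex.sub_re, Complex.sub_im, Complex.ofReal_re, Complex.ofReal_im, sub_zero]
    at p1 p2 q1 q2
  rw [abs_le] at p1 p2 q1 q2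
  obtain ⟨ha1, ha2⟩ := ha
  obtain ⟨hb1, hb2⟩ := hb
  have hΛ : 0 < Λ := by linarith
  have hnum : m ^ 2 / 2 ≤ p.re * q.re + p.im * q.im := by
    have h1 : 3 / 4 * m * (3 / 4 * m) ≤ p.re * q.re :=
      mul_le_mul (by linarith) (by linarith) (by positivity) (by linarith)
    have h2 : -(m / 4 * (m / 4)) ≤ p.im * q.im := by
      refine neg_le_of_abs_le ?_
      rw [abs_mul]
      exact mul_le_mul (abs_le.2 p2) (abs_le.2 q2) (abs_nonneg _) (by positivity)
    nlinarith
  have hden : Complex.normSq q ≤ 4 * Λ ^ 2 := by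
    rw [Complex.normSq_apply]
    have h1 : q.re * q.re ≤ (5 / 4 * Λ) * (5 / 4 * Λ) :=
      mul_self_le_mul_self (by linarith) (by linarith)
    have h2 : q.im * q.im ≤ (m / 4) * (m / 4) := by
      nlinarith [mul_nonneg (sub_nonneg.2 q2.2) (neg_le_iff_add_nonneg.1 q2.1)]
    nlinarith
  have hpos : 0 < Complex.normSq q := by
    rw [Complex.normSq_pos]
    intro h
    rw [h, Complex.zero_re] at q1
    linarith
  rw [Complex.div_re, ← add_div, div_le_div_iff₀ (by positivity) hpos]
  calc m ^ 2 * Complex.normSq q ≤ m ^ 2 * (4 * Λ ^ 2) := by gcongr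
    _ = m ^ 2 / 2 * (8 * Λ ^ 2) := by ring
    _ ≤ _ := by gcongr

/-- The holomorphic extension of the partial derivative `∂_{x_n} T_n` of the transport. -/
def transportDeriv (d : ℕ → ℝ) (f g : (ℕ → ℂ) → ℂ) (n : ℕ) (z : Fin (n + 1) → ℂ) : ℂ :=
  complexCondDensity f n (Fin.init z) (z (Fin.last n)) /
    complexCondDensity g n (complexTransport d f g n (Fin.init z))
      (complexTransport d f g (n + 1) z (Fin.last n))

section TransportDeriv

variable {M L C c : ℝ} {k : ℕ} {d : ℕ → ℝ} {f g : (ℕ → ℂ) → ℂ}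

lemma mem_nbhdBox_of_mul (hd : ∀ i, 0 < d i) (hc1 : c ≤ 1) {n : ℕ} {z : Fin n → ℂ}
    (hz : z ∈ nbhdBox fun i : Fin n => c * d i) : z ∈ nbhdBox fun i : Fin n => d i :=
  fun i => thickening_mono (by nlinarith [hd i]) _ (hz i)

lemma differentiableOn_transportDeriv (hc : SmallConst M L C) (hd : ∀ i, 0 < d i)
    (hc1 : c ≤ 1) (hcr : L / M * c ≤ M / L / 32)
    (hf : Admissible M L C (fun i : Fin k => d i) f)
    (hg : Admissible M L C (fun i : Fin k => d i) g) {n : ℕ} (hn : n < k) :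
    DifferentiableOn ℂ (transportDeriv d f g n) (nbhdBox fun i : Fin (n + 1) => c * d i) := by
  have h1 := (hf.differentiableOn_complexCondDensity hc hd hn).mono
    fun z hz => mem_nbhdBox_of_mul hd hc1 hz
  have h2 := (hg.differentiableOn_complexCondDensity hc hd hn).comp
    (differentiableOn_complexTransport hc hd hc1 hcr hf hg (Nat.succ_le_of_lt hn))
    fun z hz => complexTransport_mem_nbhdBox hc hd hc1 hcr hf hg (Nat.succ_le_of_lt hn) hz
  simp only [Function.comp_def, init_complexTransport_succ] at h2
  refine (h1.mul (h2.fun_inv fun z hz => ?_)).congr fun z _ => by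
    simp only [transportDeriv, div_eq_mul_inv, Pi.mul_apply]
  have hz' := complexTransport_mem_nbhdBox hc hd hc1 hcr hf hg (Nat.succ_le_of_lt hn) hz
  have h3 := hg.le_norm_complexCondDensity hc hd hn (init_mem_nbhdBox hz') (hz' (Fin.last n))
  rw [init_complexTransport_succ] at h3
  exact norm_pos_iff.1 (lt_of_lt_of_le (by linarith [hc.ratio_pos]) h3)

lemma transportDeriv_bounds (hc : SmallConst M L C) (hd : ∀ i, 0 < d i)
    (hc1 : c ≤ 1) (hcr : L / M * c ≤ M / L / 32)
    (hf : Admissible M L C (fun i : Fin k => d i) f)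
    (hg : Admissible M L C (fun i : Fin k => d i) g) {n : ℕ} (hn : n < k)
    {z : Fin (n + 1) → ℂ} (hz : z ∈ nbhdBox fun i : Fin (n + 1) => c * d i) :
    ‖transportDeriv d f g n z‖ ≤ 4 * (L / M) / (M / L) ∧
      (M / L) ^ 2 / (8 * (L / M) ^ 2) ≤ (transportDeriv d f g n z).re := by
  have hz1 := mem_nbhdBox_of_mul hd hc1 hz
  have hz' := complexTransport_mem_nbhdBox hc hd hc1 hcr hf hg (Nat.succ_le_of_lt hn) hz
  have hi := init_mem_nbhdBox hz'
  rw [init_complexTransport_succ] at hi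
  have hm := hc.ratio_pos
  have hΛ := hm.trans_le hc.ratio_le
  constructor
  · have h1 := hf.norm_complexCondDensity_le hc hd hn (init_mem_nbhdBox hz1) (hz1 (Fin.last n))
    have h2 := hg.le_norm_complexCondDensity hc hd hn hi (hz' (Fin.last n))
    rw [transportDeriv, norm_div]
    calc _ ≤ 2 * (L / M) / (M / L / 2) := by gcongr
      _ = _ := by ring
  · obtain ⟨a, ha, hpa⟩ := hf.exists_complexCondDensity_near hc hd hn (init_mem_nbhdBox hz1)
      (hz1 (Fin.last n))
    obtain ⟨b, hb, hqb⟩ := hg.exists_complexCondDensity_near hc hd hn hi (hz' (Fin.last n))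
    exact le_re_div_of_near hm ha hb hpa hqb

/-- Numerator and denominator are both within 24 (L/M) / d n of 1, and the denominator is at least
M/(2L) in modulus; whence 96 = 2 · 24 · 2. -/
lemma norm_transportDeriv_snoc_sub_one_le (hc : SmallConst M L C) (hd : ∀ i, 0 < d i)
    (hc0 : 0 < c) (hc1 : c ≤ 1) (hcr : L / M * c ≤ M / L / 32)
    (hf : Admissible M L C (fun i : Fin k => d i) f)
    (hg : Admissible M L C (fun i : Fin k => d i) g) {n : ℕ} (hn : n < k)
    {z : Fin n → ℂ} (hz : z ∈ nbhdBox fun i : Fin n => c * d i) {s : ℂ} (hs : s ∈ realSeg) :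
    ‖transportDeriv d f g n (Fin.snoc (α := fun _ => ℂ) z s) - 1‖ ≤
      96 * (L / M) / (M / L) / d n := by
  obtain ⟨σ, hσ, rfl⟩ := hs
  obtain ⟨x, hx, hzx⟩ := exists_real_near_of_mem_nbhdBox hz
  have hm := hc.ratio_pos
  have hdn := hd n
  have hΛ := hm.trans_le hc.ratio_le
  have hX := snoc_mem_Icc hx hσ
  have hzX : ∀ i : Fin (n + 1), ‖Fin.snoc (α := fun _ => ℂ) z (σ : ℂ) i -
      (Fin.snoc (α := fun _ => ℝ) x σ i : ℝ)‖ < c * d i := by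
    intro i
    refine Fin.lastCases ?_ (fun i => ?_) i
    · simpa using mul_pos hc0 (hd n)
    · simpa using hzx i
  have hZ := mem_nbhdBox_of_near hX hzX
  have hW := complexTransport_mem_nbhdBox hc hd hc1 hcr hf hg (Nat.succ_le_of_lt hn) hZ
  have hWi := init_mem_nbhdBox hW
  rw [init_complexTransport_succ] at hWi
  have hnear := norm_complexTransport_sub_transport_le hc hd hc1 hcr hf hg
    (Nat.succ_le_of_lt hn) hX hzX (Fin.last n)
  rw [Fin.val_last] at hnear
  have hτ := transport_mem_Icc hc hd hf hg (Nat.succ_le_of_lt hn) hX (Fin.last n)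
  -- Here the last variable is real, so the term in `L / M` drops out of the defect and the rest is
  -- bounded through min 1 (d n) ≤ 1, however large d n is.
  have hone : ‖complexTransport d f g (n + 1) (Fin.snoc (α := fun _ => ℂ) z (σ : ℂ)) (Fin.last n) -
      transport (realRestr f) (realRestr g) (n + 1) (Fin.snoc (α := fun _ => ℝ) x σ)
        (Fin.last n)‖ ≤ 1 := by
    have h := (complexTransport_succ_spec hc hd hc1 hcr hf hg hn hX hzX
      (norm_complexTransport_sub_transport_le hc hd hc1 hcr hf hg hn.le
        (fun i => hX i.castSucc) (fun i => hzX i.castSucc))).2.2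
    have h1 := hc.mul_min_le (min_le_left 1 (d n)) zero_le_one
    simp only [Fin.snoc_last, sub_self, norm_zero, mul_zero, add_zero] at h
    refine le_of_mul_le_mul_left (a := 3 / 8 * (M / L)) ?_ (by linarith)
    linarith
  have hp := hf.norm_complexCondDensity_sub_one_le hc hd hn (mem_nbhdBox_of_mul hd hc1 hz)
    (s := (σ : ℂ)) hσ (by simpa using hdn) (by simp)
  have hq := hg.norm_complexCondDensity_sub_one_le hc hd hn hWi hτ
    (hnear.trans_lt (by linarith)) hone
  have hql := hg.le_norm_complexCondDensity hc hd hn hWi (hW (Fin.last n))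
  simp only [transportDeriv, Fin.init_snoc, Fin.snoc_last] at hq hql ⊢
  set p := complexCondDensity f n z (σ : ℂ)
  set q := complexCondDensity g n (complexTransport d f g n z)
      (complexTransport d f g (n + 1) (Fin.snoc (α := fun _ => ℂ) z (σ : ℂ)) (Fin.last n))
  have hq0 : q ≠ 0 := norm_pos_iff.1 (lt_of_lt_of_le (by linarith) hql)
  have e : p / q - 1 = ((p - 1) - (q - 1)) / q := by field_simp; ring
  have hnum : ‖(p - 1) - (q - 1)‖ ≤ 48 * (L / M) / d n := by
    refine (norm_sub_le _ _).trans ((add_le_add hp hq).trans_eq ?_)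
    ring
  rw [e, norm_div]
  calc _ ≤ 48 * (L / M) / d n / (M / L / 2) := by gcongr
    _ = _ := by ring

/-- With the other variables real and fixed, the chain rule applied to G(T', h(s)) = F(x', s) gives
the complex derivative of the last component; restricting to the real axis gives the one-sided
derivatives at ±1 as well. -/
lemma extendsLastPartial_transportDeriv (hc : SmallConst M L C) (hd : ∀ i, 0 < d i)
    (hc0 : 0 < c) (hc1 : c ≤ 1) (hcr : L / M * c ≤ M / L / 32)
    (hf : Admissible M L C (fun i : Fin k => d i) f)
    (hg : Admissible M L C (fun i : Fin k => d i) g) {n : ℕ} (hn : n < k) :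
    ExtendsLastPartial (transportComp (realRestr f) (realRestr g) n) (transportDeriv d f g n) := by
  intro x hx
  have hn' : n + 1 ≤ k := hn
  have hx' : ∀ i, (Fin.init x : Fin n → ℝ) i ∈ Icc (-1 : ℝ) 1 := fun i => hx i.castSucc
  have hy' := transport_mem_Icc hc hd hf hg hn.le hx'
  have hτ := transport_mem_Icc hc hd hf hg hn' hx (Fin.last n)
  have hcd : ∀ i : ℕ, 0 < c * d i := fun i => mul_pos hc0 (hd i)
  have hupd : ∀ t : ℝ, toC (Function.update x (Fin.last n) t) =
      Fin.snoc (α := fun _ => ℂ) (toC (Fin.init x)) (t : ℂ) := by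
    intro t
    rw [← toC_snoc, ← Fin.snoc_init_self x, Fin.update_snoc_last, Fin.init_snoc]
  have htoC : toC x = Fin.snoc (α := fun _ => ℂ) (toC (Fin.init x)) (x (Fin.last n) : ℂ) := by
    rw [← hupd, Function.update_eq_self]
  have hboxi : toC (Fin.init x : Fin n → ℝ) ∈ nbhdBox fun i : Fin n => c * d i :=
    toC_mem_nbhdBox (fun i => hcd i) hx'
  have hT' := complexTransport_toC hc hd hf hg hn.le hx'
  have hT := complexTransport_toC hc hd hf hg hn' hx
  let h : ℂ → ℂ := fun s => complexTransport d f g (n + 1)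
    (Fin.snoc (α := fun _ => ℂ) (toC (Fin.init x)) s) (Fin.last n)
  have hh0 : h (x (Fin.last n)) =
      (transport (realRestr f) (realRestr g) (n + 1) x (Fin.last n) : ℝ) := by
    simp only [h]
    rw [← htoC, hT]
    rfl
  have hval : transportDeriv d f g n (toC x) =
      ((condDensity (realRestr f) n (Fin.init x) (x (Fin.last n)) /
        condDensity (realRestr g) n (transport (realRestr f) (realRestr g) n (Fin.init x))
          (transport (realRestr f) (realRestr g) (n + 1) x (Fin.last n)) : ℝ) : ℂ) := by
    rw [Complex.ofReal_div, ← hf.complexCondDensity_toC hx' (hx (Fin.last n)),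
      ← hg.complexCondDensity_toC hy' hτ, ← hT', transportDeriv, hT]
    rfl
  have hsb : (x (Fin.last n) : ℂ) ∈ thickening (c * d n) realSeg :=
    ofReal_mem_thickening (hcd n) (hx (Fin.last n))
  have hbox := snoc_mem_nbhdBox (d := fun i => c * d i) hboxi hsb
  have hhd : DifferentiableAt ℂ h (x (Fin.last n)) := by
    have h1 := ((differentiableOn_complexTransport hc hd hc1 hcr hf hg hn') _
      hbox).differentiableAt ((isOpen_nbhdBox _).mem_nhds hbox)
    have h2 := h1.comp (x (Fin.last n) : ℂ)
      (f := fun s => Fin.snoc (α := fun _ => ℂ) (toC (Fin.init x)) s)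
      (differentiableAt_snoc (differentiableAt_const _) differentiableAt_id)
    exact differentiableAt_pi.1 h2 (Fin.last n)
  have hyb : toC (transport (realRestr f) (realRestr g) n (Fin.init x)) ∈
      nbhdBox fun i : Fin n => d i := toC_mem_nbhdBox (fun i => hd i) hy'
  have hder : HasDerivAt h (transportDeriv d f g n (toC x)) (x (Fin.last n)) := by
    have h1 := hg.hasDerivAt_complexCondCDF hc hd hn hyb (s := h (x (Fin.last n))) (by
      rw [hh0]; exact ofReal_mem_thickening (hd n) hτ)
    have h2 := h1.comp (x (Fin.last n) : ℂ) hhd.hasDerivAt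
    have h3 := hf.hasDerivAt_complexCondCDF hc hd hn (mem_nbhdBox_of_mul hd hc1 hboxi)
      (ofReal_mem_thickening (hd n) (hx (Fin.last n)))
    have heq : (complexCondCDF g n (toC (transport (realRestr f) (realRestr g) n (Fin.init x)))) ∘ h
        =ᶠ[𝓝 (x (Fin.last n) : ℂ)] complexCondCDF f n (toC (Fin.init x)) := by
      filter_upwards [isOpen_thickening.mem_nhds hsb] with s hs
      have := complexCondCDF_complexTransport hc hd hc1 hcr hf hg hn
        (snoc_mem_nbhdBox (d := fun i => c * d i) hboxi hs)
      rw [Fin.init_snoc, Fin.snoc_last, hT'] at this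
      exact this
    have h4 := h2.unique (h3.congr_of_eventuallyEq heq)
    have hne : complexCondDensity g n
        (toC (transport (realRestr f) (realRestr g) n (Fin.init x))) (h (x (Fin.last n))) ≠ 0 := by
      refine norm_pos_iff.1 (lt_of_lt_of_le ?_ (hg.le_norm_complexCondDensity hc hd hn hyb
        (s := h (x (Fin.last n))) (by rw [hh0]; exact ofReal_mem_thickening (hd n) hτ)))
      linarith [hc.ratio_pos]
    have h5 : deriv h (x (Fin.last n)) = transportDeriv d f g n (toC x) := by
      have h6 : transportDeriv d f g n (toC x) =
          complexCondDensity f n (toC (Fin.init x)) (x (Fin.last n)) /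
          complexCondDensity g n (toC (transport (realRestr f) (realRestr g) n (Fin.init x)))
            (h (x (Fin.last n))) := by
        rw [hh0, transportDeriv, hT, ← hT']
        rfl
      rw [h6, eq_div_iff hne]
      -- The factor 2 undoes the halves in the derivatives of the distribution functions.
      linear_combination 2 * h4
    rw [← h5]
    exact hhd.hasDerivAt
  refine ⟨_, hval, ?_⟩
  have hre := hder.real_of_complex
  rw [hval, Complex.ofReal_re] at hre
  refine hre.hasDerivWithinAt.congr (fun t ht => ?_) ?_
  · have hux : ∀ i, Function.update x (Fin.last n) t i ∈ Icc (-1 : ℝ) 1 := fun i => by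
      rcases eq_or_ne i (Fin.last n) with rfl | hi
      · simpa using ht
      · simpa [hi] using hx i
    have := complexTransport_toC hc hd hf hg hn' hux
    simp only [h, ← hupd, this, transportComp, toC, Complex.ofReal_re]
  · rw [Function.update_eq_self, hh0, Complex.ofReal_re]
    rfl

end TransportDeriv

end KnotheRosenblatt

end

/-! ### Choice of the constants and conclusion -/

open KnotheRosenblatt in
theorem mainTheorem7 (M L : ℝ) (hM : 0 < M) (hML : M ≤ L) :
    ∃ C₆ C₇ C₈ : ℝ, 0 < C₆ ∧ C₆ ≤ 1 ∧ 0 < C₇ ∧ C₇ ≤ 1 ∧ 0 < C₈ ∧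
      ∀ (k : ℕ) (δ : Fin k → ℝ), (∀ i, 0 < δ i) →
      ∀ fρ fπ : (ℕ → ℂ) → ℂ, Admissible M L C₆ δ fρ → Admissible M L C₆ δ fπ →
      ∀ j : Fin k, ∃ R : (Fin ((j : ℕ) + 1) → ℂ) → ℂ,
        ExtendsLastPartial (transportComp (realRestr fρ) (realRestr fπ) j) R ∧
        DifferentiableOn ℂ R (nbhdBox fun i => C₇ * δ (Fin.castLE j.isLt i)) ∧
        (∀ z ∈ nbhdBox fun i => C₇ * δ (Fin.castLE j.isLt i),
          R z ∈ Metric.ball (1 : ℂ) C₈ ∧ 1 / C₈ ≤ (R z).re) ∧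
        (1 ≤ (j : ℕ) →
          ∀ z ∈ nbhdBox fun i : Fin (j : ℕ) => C₇ * δ (Fin.castLE j.isLt.le i),
          ∀ s ∈ realSeg, R (Fin.snoc z s) ∈ Metric.ball (1 : ℂ) (C₈ / δ j)) := by
  have hL : 0 < L := hM.trans_le hML
  have hm : 0 < M / L := div_pos hM hL
  have hΛ : 0 < L / M := div_pos hL hM
  have hK : 0 < 4 * L / M ^ 2 := by positivity
  let C := min 1 (min (M / 2) (M / L / 64 / (4 * L / M ^ 2)))
  let c := min 1 (M / L / 32 / (L / M))
  -- The second term covers |R| and the bound of order 1/δ_j, the third is the inverse of the lower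
  -- bound on Re R, and 2 absorbs the distance to 1 with strict inequality.
  let B := 2 + 96 * (L / M) / (M / L) + 8 * (L / M) ^ 2 / (M / L) ^ 2
  have hC0 : 0 < C := by positivity
  have hsmall : SmallConst M L C := by
    refine ⟨hM, hML, hC0.le, (min_le_right _ _).trans (min_le_left _ _), ?_⟩
    rw [mul_comm, ← le_div_iff₀ hK]
    exact (min_le_right _ _).trans (min_le_right _ _)
  have hc0 : 0 < c := by positivity
  have hc1 : c ≤ 1 := min_le_left _ _
  have hcr : L / M * c ≤ M / L / 32 := by
    rw [mul_comm, ← le_div_iff₀ hΛ]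
    exact min_le_right _ _
  have hB : 0 < B := by positivity
  refine ⟨C, c, B, hC0, min_le_left _ _, hc0, hc1, hB, ?_⟩
  intro k δ hδ fρ fπ hfρ hfπ j
  -- Extending the radii by 1 to a sequence lets every initial segment be indexed without casts; the
  -- extra values play no role.
  obtain ⟨d, hd, rfl⟩ : ∃ d : ℕ → ℝ, (∀ i, 0 < d i) ∧ δ = fun i : Fin k => d i := by
    refine ⟨fun i => if h : i < k then δ ⟨i, h⟩ else 1, fun i => ?_, funext fun i => by simp⟩
    dsimp only
    split_ifs
    · exact hδ _
    · exact one_pos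
  have hx1 : 0 < 96 * (L / M) / (M / L) := by positivity
  have hx2 : 0 < 8 * (L / M) ^ 2 / (M / L) ^ 2 := by positivity
  refine ⟨transportDeriv d fρ fπ j,
    extendsLastPartial_transportDeriv hsmall hd hc0 hc1 hcr hfρ hfπ j.isLt,
    differentiableOn_transportDeriv hsmall hd hc1 hcr hfρ hfπ j.isLt, fun z hz => ?_,
    fun _ z hz s hs => ?_⟩
  · obtain ⟨h1, h2⟩ := transportDeriv_bounds hsmall hd hc1 hcr hfρ hfπ j.isLt hz
    constructor
    · rw [Metric.mem_ball, dist_eq_norm]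
      refine (norm_sub_le _ _).trans_lt ?_
      rw [norm_one]
      have h3 : 4 * (L / M) / (M / L) ≤ 96 * (L / M) / (M / L) := by gcongr; norm_num
      simp only [B]
      linarith
    · refine le_trans ?_ h2
      have h3 : (M / L) ^ 2 / (8 * (L / M) ^ 2) = 1 / (8 * (L / M) ^ 2 / (M / L) ^ 2) := by
        rw [one_div_div]
      rw [h3]
      refine one_div_le_one_div_of_le hx2 ?_
      simp only [B]
      linarith
  · rw [Metric.mem_ball, dist_eq_norm]
    refine (norm_transportDeriv_snoc_sub_one_le hsmall hd hc0 hc1 hcr hfρ hfπ j.isLt hz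
      hs).trans_lt ?_
    refine div_lt_div_of_pos_right ?_ (hd j)
    simp only [B]
    linarith
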